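/- Let $F_A$ be the free group on a set $A$. For $m\ge 1$ let $\mathbf{Ab}(m)$ be the pseudovariety of all finite abelian groups whose exponent divides $m$. The pro-$\mathbf{Ab}(m)$ topology on $F_A$ is the coarsest topology for which every homomorphism from $F_A$ to a (discrete) group in $\mathbf{Ab}(m)$ is continuous. For a subgroup $H\le F_A$, $\mathrm{Cl}_{\mathbf{Ab}(m)}(H)$ denotes the closure of $H$ in this topology, and $H$ is $\mathbf{Ab}(m)$-closed (resp. $\mathbf{Ab}(m)$-dense) if it is closed (resp. dense) in it. Let $F_A'$ be the derived subgroup of $F_A$ and $F_A^m$ the subgroup generated by all $m$-th powers. Theorem. Let $A$ be a set (of arbitrary cardinality), $m\ge 1$, and let $H$ be a finitely generated subgroup of $F_A$. Then: (i) $\mathrm{Cl}_{\mathbf{Ab}(m)}(H)=HF_A'F_A^m$; (ii) $\mathrm{Cl}_{\mathbf{Ab}(m)}(H)$ is finitely generated if and only if $A$ is finite; (iii) it is decidable whether or not $\mathrm{Cl}_{\mathbf{Ab}(m)}(H)$ is finitely generated; (iv) if $\mathrm{Cl}_{\mathbf{Ab}(m)}(H)$ is finitely generated, then a (finite) basis of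 this free group can be computed; (v) it is decidable whether or not $H$ is $\mathbf{Ab}(m)$-closed; (vi) $H$ is $\mathbf{Ab}(m)$-dense if and only if $H$ is $\mathbf{Ab}(p)$-dense for every prime $p$ dividing $m$; (vii) it is decidable whether or not $H$ is $\mathbf{Ab}(m)$-dense; (viii) the membership problem for $\mathrm{Cl}_{\mathbf{Ab}(m)}(H)$ is decidable; (ix) if $A$ is finite, then there are a recursively enumerable set $B$ of words representing (bijectively) a basis of $\mathrm{Cl}_{\mathbf{Ab}(m)}(H)$ and an algorithm which expresses every element of $\mathrm{Cl}_{\mathbf{Ab}(m)}(H)$ as a word on $B$. In the algorithmic statements (iii), (iv), (v), (vii), (viii), (ix) the input consists of the number of letters of $A$ (a natural number, or the information that $A$ is infinite), the integer $m\ge1$, a finite list of words generating $H$ and, in (viii) and in the algorithm of (ix), a further word. Words are finite sequences of letters and inverse letters, the letters being referred to by natural numbers: $0,\dots,n-1$ if $A$ has $n$ letters (any other number stands for the identity), and through an arbitrary injection $\mathbb{N}\to A$ if $A$ is infinite. The algorithms, and the enumeration of $B$, are uniform in this input. -/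

import Mathlib

open scoped Pointwise

universe u v

namespace ProV

/-- The pro-`V` topology on a group `G`, for a class `V` of groups: the coarsest topology on `G`
for which all homomorphisms from `G` into members of `V` (with the discrete topology) are
continuous. -/
@[reducible] def proTopology (V : (Q : Type u) → [Group Q] → Prop) (G : Type u) [Group G] :
    TopologicalSpace G :=
  ⨅ (Q : Type u) (_ : Group Q) (_ : V Q) (φ : G →* Q), TopologicalSpace.induced φ ⊥

theorem isTopologicalGroup_proTopology (V : (Q : Type u) → [Group Q] → Prop) (G : Type u)
    [Group G] : @IsTopologicalGroup G (proTopology V G) _ := by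
  refine topologicalGroup_iInf fun Q => topologicalGroup_iInf fun _ =>
    topologicalGroup_iInf fun _ => topologicalGroup_iInf fun φ => ?_
  let _ : TopologicalSpace Q := ⊥
  have : DiscreteTopology Q := ⟨rfl⟩
  exact topologicalGroup_induced φ

/-- The closure of a subgroup in the pro-`V` topology; it is again a subgroup. -/
def proClosure (V : (Q : Type u) → [Group Q] → Prop) {G : Type u} [Group G]
    (H : Subgroup G) : Subgroup G :=
  @Subgroup.topologicalClosure G (proTopology V G) _ (isTopologicalGroup_proTopology V G) H

/-- `H` is closed in the pro-`V` topology. -/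
def IsProClosed (V : (Q : Type u) → [Group Q] → Prop) {G : Type u} [Group G]
    (H : Subgroup G) : Prop :=
  @IsClosed G (proTopology V G) (H : Set G)

/-- `H` is dense in the pro-`V` topology. -/
def IsProDense (V : (Q : Type u) → [Group Q] → Prop) {G : Type u} [Group G]
    (H : Subgroup G) : Prop :=
  @Dense G (proTopology V G) (H : Set G)

/-- The pseudovariety `Ab(m)` of finite abelian groups whose exponent divides `m`. -/
structure Ab (m : ℕ) (Q : Type u) [Group Q] : Prop where
  finite : Finite Q
  comm : ∀ x y : Q, x * y = y * x
  exponent_dvd : Monoid.exponent Q ∣ m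

/-- The subgroup `G ^ m` generated by the `m`-th powers of the elements of `G`. -/
def powSubgroup (G : Type u) [Group G] (m : ℕ) : Subgroup G :=
  Subgroup.closure (Set.range fun g : G => g ^ m)

/-- The family `x` of elements of `G` is a basis of the subgroup `K`: it consists of elements of
`K`, and `K` is free on it. -/
def IsBasisOf {ι : Type v} {G : Type u} [Group G] (x : ι → G) (K : Subgroup G) : Prop :=
  ∃ b : FreeGroupBasis ι K, ∀ i, ((b i : K) : G) = x i

/-- The value in `G` of the word `w` in the elements `x i` and their inverses; `(i, true)` stands
for `x i` and `(i, false)` for its inverse. -/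
def evalWord {ι : Type v} {G : Type u} [Group G] (x : ι → G) (w : List (ι × Bool)) : G :=
  (w.map fun p => if p.2 then x p.1 else (x p.1)⁻¹).prod

/-- Words as algorithms handle them: letters are referred to by natural numbers; `(k, true)` is
the letter with number `k` and `(k, false)` is its inverse. -/
abbrev Word : Type := List (ℕ × Bool)

/-- A way of referring to letters of an arbitrary alphabet `A` by natural numbers. If `A` is
finite, its `n` letters are numbered `0, …, n - 1`. If `A` is infinite, of any cardinality,
the numbers refer to pairwise distinct letters of `A`; any finitely many letters of `A` can be
given numbers in this way. -/
inductive Naming (A : Type u) : Type u where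
  | finite (n : ℕ) (e : Fin n ≃ A) : Naming A
  | infinite (e : ℕ ↪ A) : Naming A

namespace Naming

variable {A : Type u}

/-- What an algorithm is told about the alphabet: the number of letters, or that there are
infinitely many (`none`). -/
def size : Naming A → Option ℕ
  | finite n _ => some n
  | infinite _ => none

/-- The free generator with number `k`; a number that refers to no letter stands for `1`. -/
def gen : Naming A → ℕ → FreeGroup A
  | finite n e, k => if h : k < n then FreeGroup.of (e ⟨k, h⟩) else 1
  | infinite e, k => FreeGroup.of (e k)

/-- The element of the free group on `A` represented by a word. -/
def elt (ν : Naming A) (w : Word) : FreeGroup A :=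
  evalWord ν.gen w

/-- The subgroup of the free group on `A` generated by a finite list of words. -/
def subgroup (ν : Naming A) (L : List Word) : Subgroup (FreeGroup A) :=
  Subgroup.closure {g | ∃ w ∈ L, ν.elt w = g}

end Naming

/-- The input of the algorithms: the number of letters of the alphabet (`none` if it is infinite),
the exponent `m`, and a finite list of words generating `H`. -/
abbrev Input : Type := Option ℕ × ℕ × List Word

/-- The property `P m H` of positive integers `m` and finitely generated subgroups `H` of free
groups, over arbitrary alphabets in `Type u`, is decided by an algorithm. -/
def IsDecidable (P : (A : Type u) → ℕ → Subgroup (FreeGroup A) → Prop) : Prop :=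
  ∃ f : Input → Bool, Computable f ∧
    ∀ (A : Type u) (ν : Naming A) (m : ℕ) (L : List Word), 1 ≤ m →
      (f (ν.size, m, L) = true ↔ P A m (ν.subgroup L))

end ProV

/-! Every homomorphism from G to a member of Ab(m) kills the verbal subgroup G'G^m, so the pro-Ab(m)
topology is coarser than the one pulled back from the discrete group G/G'G^m, and a closed subgroup
contains G'G^m. Conversely, if H contains G'G^m, then G/H is abelian of exponent dividing m. Its
characters into ℚ/ℤ take values in the finite m-torsion and separate points, so H is closed
(`isProClosed_ab_iff`). Hence the closure of H is HG'G^m, in any group G, and density is the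
triviality of G/HG'G^m.

For the free group F on A, F/F'F^m is the free ℤ/m-module on A (`ker_expSum`). If A is finite, the
closure therefore has finite index and is finitely generated. If A is infinite, H misses a letter a,
while the closure contains a^m; this settles finite generation, closedness and density. Membership
in the closure is arithmetic: up to exponent sums modulo m, the elements of H are the finitely many
products v₁^j₁ ⋯ v_k^j_k of its generators with 0 ≤ j_i < m (`memClosure_iff`).

The other algorithms, for finite A, are unbounded searches with a decidable test and a proof that a
solution exists. For a basis, one searches for a Schreier transversal of the closure and takes the
nontrivial Schreier generators, which form a basis by Nielsen–Schreier (`isBasisOf_schreierGen`).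
Expressions in that basis are found by trying all words. For closedness, one asks whether all the
basis words lie in H: if so, each has an expression in the generators; if not, M. Hall's theorem
gives finitely supported permutations separating one from H (`exists_isSeparating`). Either outcome
is a checkable certificate. -/

open scoped Topology

namespace ProV

/-! ### The pro-Ab(m) topology and the verbal subgroup G'G^m -/

section Verbal

variable (G : Type u) [Group G] (m : ℕ)

instance normal_powSubgroup : (powSubgroup G m).Normal where
  conj_mem n hn g := by
    induction hn using Subgroup.closure_induction with
    | mem x hx =>
      obtain ⟨y, rfl⟩ := hx
      exact Subgroup.subset_closure ⟨g * y * g⁻¹, by simp [conj_pow]⟩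
    | one => simp
    | mul x y _ _ hx hy => simpa [mul_assoc] using mul_mem hx hy
    | inv x _ hx => simpa [mul_assoc] using inv_mem hx

/-- The verbal subgroup `G' G ^ m`, the smallest normal subgroup with an abelian quotient of
exponent dividing `m`. -/
def abVerbal : Subgroup G := commutator G ⊔ powSubgroup G m

instance normal_abVerbal : (abVerbal G m).Normal := Subgroup.sup_normal _ _

variable {G m}

theorem pow_mem_abVerbal (g : G) : g ^ m ∈ abVerbal G m :=
  le_sup_right (a := commutator G) (Subgroup.subset_closure ⟨g, rfl⟩)

theorem commutator_le_abVerbal : commutator G ≤ abVerbal G m := le_sup_left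

theorem abVerbal_le_ker {Q : Type v} [Group Q] (hc : ∀ x y : Q, x * y = y * x)
    (hm : ∀ x : Q, x ^ m = 1) (φ : G →* Q) : abVerbal G m ≤ φ.ker := by
  refine sup_le ?_ ?_
  · rw [commutator_def, Subgroup.commutator_le]
    intro x _ y _
    rw [MonoidHom.mem_ker, map_commutatorElement, commutatorElement_eq_one_iff_mul_comm, hc]
  · rw [powSubgroup, Subgroup.closure_le]
    rintro _ ⟨x, rfl⟩
    simp [MonoidHom.mem_ker, hm]

theorem quotient_mul_comm {N : Subgroup G} [N.Normal] (h : abVerbal G m ≤ N) (x y : G ⧸ N) :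
    x * y = y * x := by
  induction x using QuotientGroup.induction_on with | H x => ?_
  induction y using QuotientGroup.induction_on with | H y => ?_
  rw [← commutatorElement_eq_one_iff_mul_comm, ← QuotientGroup.mk'_apply, ← QuotientGroup.mk'_apply,
    ← map_commutatorElement, QuotientGroup.mk'_apply, QuotientGroup.eq_one_iff]
  exact h (commutator_le_abVerbal (Subgroup.commutator_mem_commutator trivial trivial))

theorem quotient_pow_eq_one {N : Subgroup G} [N.Normal] (h : abVerbal G m ≤ N) (x : G ⧸ N) :
    x ^ m = 1 := by
  induction x using QuotientGroup.induction_on with | H x => ?_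
  rw [← QuotientGroup.mk_pow, QuotientGroup.eq_one_iff]
  exact h (pow_mem_abVerbal x)

theorem normal_of_abVerbal_le {H : Subgroup G} (h : abVerbal G m ≤ H) : H.Normal :=
  Subgroup.Normal.of_commutator_le G (commutator_le_abVerbal.trans h)

/-- Subgroups containing `G' G ^ m` are separated from the elements outside by homomorphisms to
finite abelian groups of exponent dividing `m`. -/
theorem exists_ab_hom_ne_one (hm : 1 ≤ m) {H : Subgroup G} (h : abVerbal G m ≤ H) {g : G}
    (hg : g ∉ H) :
    ∃ (Q : Type u) (_ : Group Q) (_ : Ab m Q) (φ : G →* Q), H ≤ φ.ker ∧ φ g ≠ 1 := by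
  have hN := normal_of_abVerbal_le h
  let _ : CommGroup (G ⧸ H) :=
    { (inferInstance : Group (G ⧸ H)) with mul_comm := quotient_mul_comm h }
  have hg' : Additive.ofMul (g : G ⧸ H) ≠ 0 := by
    rw [Ne, ofMul_eq_zero, QuotientGroup.eq_one_iff]
    exact hg
  -- G/H may be infinite. A character into ℚ/ℤ nontrivial at g has its values in the m-torsion,
  -- which is finite for m ≥ 1, so the quotient by its kernel belongs to Ab(m).
  obtain ⟨c, hc⟩ := CharacterModule.exists_character_apply_ne_zero_of_ne_zero hg'
  let χ : G →* Multiplicative (AddCircle (1 : ℚ)) :=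
    (AddMonoidHom.toMultiplicativeRight c).comp (QuotientGroup.mk' H)
  have hχ (x : G) : χ x = Multiplicative.ofAdd (c (Additive.ofMul (x : G ⧸ H))) := rfl
  have hpow (x : G) : m • c (Additive.ofMul (x : G ⧸ H)) = 0 := by
    rw [← map_nsmul, ← ofMul_pow, quotient_pow_eq_one h]
    simp
  refine ⟨G ⧸ χ.ker, inferInstance, ⟨?_, ?_, ?_⟩, QuotientGroup.mk' _, ?_, ?_⟩
  · have : Finite χ.range := by
      refine ((AddCircle.finite_torsion (1 : ℚ) hm).image Multiplicative.ofAdd).subset ?_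
      rintro _ ⟨x, rfl⟩
      exact ⟨_, hpow x, (hχ x).symm⟩
    exact Finite.of_equiv _ (QuotientGroup.quotientKerEquivRange χ).symm.toEquiv
  · intro x y
    apply (QuotientGroup.quotientKerEquivRange χ).injective
    rw [map_mul, map_mul, mul_comm]
  · refine Monoid.exponent_dvd_of_forall_pow_eq_one fun x => ?_
    induction x using QuotientGroup.induction_on with | H x => ?_
    rw [← QuotientGroup.mk_pow, QuotientGroup.eq_one_iff, MonoidHom.mem_ker, map_pow, hχ,
      ← ofAdd_nsmul, hpow, ofAdd_zero]
  · rw [QuotientGroup.ker_mk']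
    intro x hx
    rw [MonoidHom.mem_ker, hχ, (QuotientGroup.eq_one_iff x).2 hx]
    simp
  · rw [QuotientGroup.mk'_apply, Ne, QuotientGroup.eq_one_iff, MonoidHom.mem_ker, hχ]
    simpa using hc

theorem Ab.pow_eq_one {Q : Type u} [Group Q] (h : Ab m Q) (x : Q) : x ^ m = 1 :=
  Monoid.exponent_dvd_iff_forall_pow_eq_one.1 h.exponent_dvd x

theorem isOpen_preimage_of_ab {Q : Type u} [Group Q] (h : Ab m Q) (φ : G →* Q) (s : Set Q) :
    IsOpen[proTopology (Ab m) G] (φ ⁻¹' s) :=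
  have : proTopology (Ab m) G ≤ TopologicalSpace.induced φ ⊥ :=
    (iInf_le _ Q).trans <| (iInf_le _ ‹_›).trans <| (iInf_le _ h).trans (iInf_le _ φ)
  this _ ⟨s, trivial, rfl⟩

/-- Homomorphisms to members of Ab(m) factor through G/G'G^m. Only this inequality is claimed:
G/G'G^m may be infinite, and then it is not itself in Ab(m). -/
theorem induced_mk_le_proTopology :
    TopologicalSpace.induced (QuotientGroup.mk' (abVerbal G m)) ⊥ ≤ proTopology (Ab m) G := by
  refine le_iInf fun Q => le_iInf fun _ => le_iInf fun h => le_iInf fun φ => ?_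
  have hφ : φ = (QuotientGroup.lift _ φ (abVerbal_le_ker h.comm h.pow_eq_one φ)).comp
      (QuotientGroup.mk' (abVerbal G m)) := rfl
  rw [hφ, MonoidHom.coe_comp, ← induced_compose]
  exact induced_mono bot_le

/-- The subgroups closed in the pro-`Ab(m)` topology are those containing `G' G ^ m`. -/
theorem isProClosed_ab_iff (hm : 1 ≤ m) (H : Subgroup G) :
    IsProClosed (Ab m) H ↔ abVerbal G m ≤ H := by
  refine ⟨fun h x hx => ?_, fun h => ?_⟩
  -- H is closed in the finer topology as well, hence a union of cosets of G'G^m; as it contains 1,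
  -- it contains G'G^m.
  · have h' : IsClosed[TopologicalSpace.induced (QuotientGroup.mk' (abVerbal G m)) ⊥]
        (H : Set G) := by
      rw [← @isOpen_compl_iff _ _ (TopologicalSpace.induced _ _)]
      exact induced_mk_le_proTopology _ ((@isOpen_compl_iff _ _ (proTopology (Ab m) G)).2 h)
    rw [@isClosed_induced_iff] at h'
    obtain ⟨t, -, ht⟩ := h'
    have h1 : (1 : G) ∈ (H : Set G) := H.one_mem
    rw [← ht] at h1
    change x ∈ (H : Set G)
    rw [← ht]
    simpa [(QuotientGroup.eq_one_iff x).2 hx] using h1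
  · refine @IsClosed.mk _ (proTopology (Ab m) G) _ ?_
    refine (@isOpen_iff_forall_mem_open _ (proTopology (Ab m) G) _).2 fun g hg => ?_
    obtain ⟨Q, _, hQ, φ, hφ, hne⟩ := exists_ab_hom_ne_one hm h hg
    refine ⟨φ ⁻¹' {1}ᶜ, fun x hx hxH => hx (hφ hxH), isOpen_preimage_of_ab hQ φ _, hne⟩

theorem proClosure_ab (hm : 1 ≤ m) (H : Subgroup G) :
    proClosure (Ab m) H = H ⊔ abVerbal G m := by
  let _ := proTopology (Ab m) G
  have := isTopologicalGroup_proTopology (Ab m) G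
  refine le_antisymm ?_ (sup_le ?_ ?_)
  · exact Subgroup.topologicalClosure_minimal _ le_sup_left
      ((isProClosed_ab_iff hm _).2 le_sup_right)
  · exact Subgroup.le_topologicalClosure H
  · exact (isProClosed_ab_iff hm _).1 (Subgroup.isClosed_topologicalClosure H)

theorem isProDense_ab_iff (hm : 1 ≤ m) (H : Subgroup G) :
    IsProDense (Ab m) H ↔ H ⊔ abVerbal G m = ⊤ := by
  let _ := proTopology (Ab m) G
  have := isTopologicalGroup_proTopology (Ab m) G
  rw [← proClosure_ab hm, ← SetLike.coe_set_eq]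
  exact dense_iff_closure_eq

theorem coe_proClosure_ab (hm : 1 ≤ m) (H : Subgroup G) :
    (proClosure (Ab m) H : Set G) = (H : Set G) * (commutator G : Set G) *
      (powSubgroup G m : Set G) := by
  rw [proClosure_ab hm, abVerbal, ← sup_assoc, Subgroup.mul_normal, Subgroup.mul_normal]

theorem abVerbal_anti {p : ℕ} (h : p ∣ m) : abVerbal G m ≤ abVerbal G p := by
  obtain ⟨k, rfl⟩ := h
  refine sup_le le_sup_left ?_
  rw [powSubgroup, Subgroup.closure_le]
  rintro _ ⟨x, rfl⟩
  simpa [pow_mul] using pow_mem (pow_mem_abVerbal x) k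

/-- Let Q = G/HG'G^m. Density for p makes every element of Q a p-th power. Going through the prime
factors of m, every element of Q is an m-th power, hence trivial. -/
theorem isProDense_ab_iff_forall_prime (hm : 1 ≤ m) (H : Subgroup G) :
    IsProDense (Ab m) H ↔ ∀ p : ℕ, p.Prime → p ∣ m → IsProDense (Ab p) H := by
  rw [isProDense_ab_iff hm]
  refine ⟨fun h p hp hpm => (isProDense_ab_iff hp.one_le H).2 ?_, fun h => ?_⟩
  · exact top_unique (h ▸ sup_le_sup_left (abVerbal_anti hpm) H)
  -- Multiplicative induction over the divisors k of m: every element is a k-th power in the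
  -- quotient.
  · have key (k : ℕ) (hk : k ∣ m) (hk0 : k ≠ 0) (g : G) :
        ∃ x, g⁻¹ * x ^ k ∈ H ⊔ abVerbal G m := by
      induction k using Nat.recOnMul generalizing g with
      | zero => exact absurd rfl hk0
      | one => exact ⟨g, by simp⟩
      | prime p hp =>
        have hN := normal_of_abVerbal_le (le_sup_right : abVerbal G m ≤ H ⊔ abVerbal G m)
        have hcomm := quotient_mul_comm (le_sup_right : abVerbal G m ≤ H ⊔ abVerbal G m)
        let _ : CommGroup (G ⧸ (H ⊔ abVerbal G m)) := { mul_comm := hcomm }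
        -- The preimage of the p-th powers of the quotient contains H, the commutators and all p-th
        -- powers, so density for p makes it everything.
        let K : Subgroup G := ((powMonoidHom p : G ⧸ (H ⊔ abVerbal G m) →* _).range).comap
          (QuotientGroup.mk' (H ⊔ abVerbal G m))
        have hK : H ⊔ abVerbal G p ≤ K := by
          refine sup_le (fun x hx => ?_) (sup_le ?_ ?_)
          · exact ⟨1, by simpa using ((QuotientGroup.eq_one_iff x).2 (le_sup_left (a := H) hx)).symm⟩
          · intro x hx
            refine ⟨1, ?_⟩
            simpa using ((QuotientGroup.eq_one_iff x).2
              (le_sup_right (a := H) (commutator_le_abVerbal hx))).symm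
          · rw [powSubgroup, Subgroup.closure_le]
            rintro _ ⟨x, rfl⟩
            exact ⟨(x : G ⧸ (H ⊔ abVerbal G m)), by simp⟩
        rw [(isProDense_ab_iff hp.one_le H).1 (h p hp hk)] at hK
        obtain ⟨x, hx⟩ := hK (Subgroup.mem_top g)
        induction x using QuotientGroup.induction_on with | H x => ?_
        refine ⟨x, QuotientGroup.eq.1 ?_⟩
        simpa using hx.symm
      | mul a b iha ihb =>
        have hN := normal_of_abVerbal_le (le_sup_right : abVerbal G m ≤ H ⊔ abVerbal G m)
        obtain ⟨x, hx⟩ := iha (dvd_of_mul_right_dvd hk) (left_ne_zero_of_mul hk0) g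
        obtain ⟨y, hy⟩ := ihb (dvd_of_mul_left_dvd hk) (right_ne_zero_of_mul hk0) x
        refine ⟨y, ?_⟩
        rw [← QuotientGroup.eq] at hx hy ⊢
        rw [hx, mul_comm a b, pow_mul, QuotientGroup.mk_pow, QuotientGroup.mk_pow, hy,
          QuotientGroup.mk_pow]
    refine top_unique fun g _ => ?_
    obtain ⟨x, hx⟩ := key m dvd_rfl (by lia) g
    simpa using mul_mem (le_sup_right (a := H) (pow_mem_abVerbal x)) (inv_mem hx)

end Verbal

/-! ### Exponent sums modulo m, and infinite alphabets -/

section Exponents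

variable {A : Type u}

/-- The exponent sums, modulo `m`, of the letters in an element of the free group. -/
noncomputable def expSum (m : ℕ) : FreeGroup A →* Multiplicative (A →₀ ZMod m) :=
  FreeGroup.lift fun a => Multiplicative.ofAdd (Finsupp.single a 1)

@[simp]
theorem expSum_of (m : ℕ) (a : A) :
    expSum m (FreeGroup.of a) = Multiplicative.ofAdd (Finsupp.single a 1) := by
  simp [expSum]

/-- Sending the basis vector of a to the class of the generator a defines a map γ from the free
ℤ/m-module back to F/F'F^m. Its composite with `expSum` is the quotient map, so the kernel of
`expSum` is no larger than F'F^m. -/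
theorem ker_expSum (m : ℕ) : (expSum (A := A) m).ker = abVerbal (FreeGroup A) m := by
  refine le_antisymm (fun g hg => ?_) (abVerbal_le_ker mul_comm (fun x => ?_) _)
  · let _ : CommGroup (FreeGroup A ⧸ abVerbal (FreeGroup A) m) :=
      { mul_comm := quotient_mul_comm le_rfl }
    let δ (a : A) : { f : ℤ →+ Additive (FreeGroup A ⧸ abVerbal (FreeGroup A) m) // f m = 0 } :=
      ⟨zmultiplesHom _ (Additive.ofMul (FreeGroup.of a : FreeGroup A ⧸ _)), by
        simp only [zmultiplesHom_apply, natCast_zsmul]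
        rw [← ofMul_pow, quotient_pow_eq_one le_rfl, ofMul_one]⟩
    let γ : (A →₀ ZMod m) →+ Additive (FreeGroup A ⧸ abVerbal (FreeGroup A) m) :=
      Finsupp.liftAddHom fun a => ZMod.lift m (δ a)
    have : (AddMonoidHom.toMultiplicativeLeft γ).comp (expSum m) = QuotientGroup.mk' _ := by
      ext a
      have h1 : ZMod.lift m (δ a) 1 = Additive.ofMul (FreeGroup.of a : FreeGroup A ⧸ _) := by
        simpa [δ] using ZMod.lift_coe m (δ a) 1
      simp [γ, h1]
    rw [← QuotientGroup.eq_one_iff, ← QuotientGroup.mk'_apply, ← this, MonoidHom.comp_apply,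
      MonoidHom.mem_ker.1 hg, map_one]
  · rw [← toAdd_eq_zero, toAdd_pow]
    ext a
    simp

theorem finite_quotient_abVerbal [Finite A] {m : ℕ} (hm : 1 ≤ m) :
    Finite (FreeGroup A ⧸ abVerbal (FreeGroup A) m) := by
  have : NeZero m := ⟨by lia⟩
  have : Finite (A →₀ ZMod m) := Finite.of_injective _ DFunLike.coe_injective
  rw [← ker_expSum]
  exact Finite.of_injective _ (QuotientGroup.kerLift_injective (expSum (A := A) m))

theorem finiteIndex_of_abVerbal_le [Finite A] {m : ℕ} (hm : 1 ≤ m) {K : Subgroup (FreeGroup A)}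
    (hK : abVerbal (FreeGroup A) m ≤ K) : K.FiniteIndex := by
  have := finite_quotient_abVerbal (A := A) hm
  have : (abVerbal (FreeGroup A) m).FiniteIndex := Subgroup.finiteIndex_of_finite_quotient
  exact Subgroup.finiteIndex_of_le hK

/-- The elements of a finitely generated subgroup do not involve all the letters of an infinite
alphabet. -/
theorem exists_letter_expSum_eq_zero [Infinite A] (m : ℕ) {H : Subgroup (FreeGroup A)}
    (hH : H.FG) : ∃ a : A, ∀ g ∈ H, (expSum m g).toAdd a = 0 := by
  classical
  obtain ⟨S, rfl⟩ := hH
  obtain ⟨a, ha⟩ := Infinite.exists_notMem_finset (S.biUnion fun g => (expSum m g).toAdd.support)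
  refine ⟨a, fun g hg => ?_⟩
  induction hg using Subgroup.closure_induction with
  | mem x hx =>
    by_contra h
    exact ha (Finset.mem_biUnion.2 ⟨x, hx, Finsupp.mem_support_iff.2 h⟩)
  | one => simp
  | mul x y _ _ hx hy => simp [hx, hy]
  | inv x _ hx => simp [hx]

theorem finite_of_fg_of_abVerbal_le {m : ℕ} (hm : 1 ≤ m) {K : Subgroup (FreeGroup A)}
    (hK : abVerbal (FreeGroup A) m ≤ K) (h : K.FG) : Finite A := by
  by_contra hA
  rw [not_finite_iff_infinite] at hA
  -- Integral exponent sums (modulus 0) are needed here: that of a^m at a is m, which vanishes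
  -- modulo m.
  obtain ⟨a, ha⟩ := exists_letter_expSum_eq_zero 0 h
  have h0 : m = 0 := by simpa using ha _ (hK (pow_mem_abVerbal (FreeGroup.of a)))
  lia

theorem proClosure_ab_fg_iff {m : ℕ} (hm : 1 ≤ m) (H : Subgroup (FreeGroup A)) :
    (proClosure (Ab m) H).FG ↔ Finite A := by
  rw [proClosure_ab hm]
  refine ⟨finite_of_fg_of_abVerbal_le hm le_sup_right, fun _ => ?_⟩
  have := finiteIndex_of_abVerbal_le hm (le_sup_right : abVerbal (FreeGroup A) m ≤ H ⊔ _)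
  rw [← Group.fg_iff_subgroup_fg]
  exact Subgroup.fg_of_index_ne_zero _

theorem isProClosed_ab_iff_proClosure_le {m : ℕ} (hm : 1 ≤ m) (H : Subgroup (FreeGroup A)) :
    IsProClosed (Ab m) H ↔ proClosure (Ab m) H ≤ H := by
  rw [isProClosed_ab_iff hm, proClosure_ab hm]
  simp

theorem not_isProClosed_ab_of_infinite [Infinite A] {m : ℕ} (hm : 1 ≤ m)
    {H : Subgroup (FreeGroup A)} (hH : H.FG) : ¬ IsProClosed (Ab m) H := fun h =>
  not_finite_iff_infinite.2 ‹_› <|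
    finite_of_fg_of_abVerbal_le hm ((isProClosed_ab_iff hm H).1 h) hH

/-- A letter whose exponent sum vanishes on H has vanishing exponent sum modulo m on the whole
closure. Density then forces 1 = 0 in ℤ/m. -/
theorem isProDense_ab_iff_of_infinite [Infinite A] {m : ℕ} (hm : 1 ≤ m)
    {H : Subgroup (FreeGroup A)} (hH : H.FG) : IsProDense (Ab m) H ↔ m = 1 := by
  rw [isProDense_ab_iff hm]
  refine ⟨fun h => ?_, ?_⟩
  · obtain ⟨a, ha⟩ := exists_letter_expSum_eq_zero m hH
    have hle : H ⊔ abVerbal (FreeGroup A) m ≤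
        ((AddMonoidHom.toMultiplicative (Finsupp.applyAddHom a)).comp (expSum m)).ker := by
      refine sup_le (fun g hg => ha g hg) ?_
      rw [← ker_expSum]
      intro g hg
      simp [MonoidHom.mem_ker, MonoidHom.mem_ker.1 hg]
    have h1 : (1 : ZMod m) = 0 := by
      have := hle (h ▸ Subgroup.mem_top (FreeGroup.of a))
      rw [MonoidHom.mem_ker, MonoidHom.comp_apply, expSum_of] at this
      simpa using this
    rcases hm.lt_or_eq with h2 | h2
    · have : Fact (1 < m) := ⟨h2⟩
      exact absurd h1 one_ne_zero
    · exact h2.symm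
  · rintro rfl
    refine top_unique fun g _ => le_sup_right (a := H) ?_
    simpa using pow_mem_abVerbal (m := 1) g

end Exponents

/-! ### The Nielsen–Schreier theorem by labelled coset graphs -/

section Schreier

variable {A : Type u} {K : Subgroup (FreeGroup A)} (r : FreeGroup A ⧸ K → FreeGroup A)

/-- The pairs of a coset and a letter giving nontrivial Schreier generators. -/
abbrev SchreierIndex : Type u :=
  {p : (FreeGroup A ⧸ K) × A // r (FreeGroup.of p.2 • p.1) ≠ FreeGroup.of p.2 * r p.1}

variable {r}

/-- The Schreier generator with a given index. -/
def schreierGen (p : SchreierIndex r) : FreeGroup A :=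
  (r (FreeGroup.of p.1.2 • p.1.1))⁻¹ * (FreeGroup.of p.1.2 * r p.1.1)

variable (r)

open Classical in
/-- The label of an edge of the Schreier graph: trivial on the tree given by `r`. -/
noncomputable def schreierLabel (x : FreeGroup A ⧸ K) (a : A) : FreeGroup (SchreierIndex r) :=
  if h : r (FreeGroup.of a • x) ≠ FreeGroup.of a * r x then FreeGroup.of ⟨(x, a), h⟩ else 1

/-- The action of the free group on labelled cosets. -/
noncomputable def schreierAction :
    FreeGroup A →* Equiv.Perm ((FreeGroup A ⧸ K) × FreeGroup (SchreierIndex r)) :=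
  FreeGroup.lift fun a => Equiv.prodShear (MulAction.toPerm (FreeGroup.of a))
    fun x => Equiv.mulLeft (schreierLabel r x a)

/-- The label of the path which starts at the coset `x` and reads `g`. -/
noncomputable def pathLabel (g : FreeGroup A) (x : FreeGroup A ⧸ K) :
    FreeGroup (SchreierIndex r) :=
  (schreierAction r g (x, 1)).2

theorem schreierAction_of (a : A) (x : FreeGroup A ⧸ K) (h : FreeGroup (SchreierIndex r)) :
    schreierAction r (FreeGroup.of a) (x, h) = (FreeGroup.of a • x, schreierLabel r x a * h) := by
  simp [schreierAction, Equiv.prodShear]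

theorem schreierAction_inv_of (a : A) (x : FreeGroup A ⧸ K) (h : FreeGroup (SchreierIndex r)) :
    schreierAction r (FreeGroup.of a)⁻¹ (x, h) = ((FreeGroup.of a)⁻¹ • x,
      (schreierLabel r ((FreeGroup.of a)⁻¹ • x) a)⁻¹ * h) := by
  rw [map_inv, Equiv.Perm.inv_eq_iff_eq, schreierAction_of]
  simp

/-- The action multiplies labels on the left, so it commutes with right multiplication of labels,
and the label collected along g does not depend on the initial one. -/
theorem schreierAction_apply (g : FreeGroup A) (x : FreeGroup A ⧸ K)
    (h : FreeGroup (SchreierIndex r)) :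
    schreierAction r g (x, h) = (g • x, pathLabel r g x * h) := by
  induction g using FreeGroup.induction_on generalizing x h with
  | C1 => simp [pathLabel]
  | of a => simp [pathLabel, schreierAction_of]
  | inv_of a _ =>
    rw [pathLabel, schreierAction_inv_of, schreierAction_inv_of]
    simp
  | mul g₁ g₂ h₁ h₂ =>
    simp only [pathLabel, map_mul, Equiv.Perm.mul_apply]
    rw [h₂, h₂ x 1, h₁, h₁ _ (_ * 1)]
    simp [mul_smul, mul_assoc]

theorem pathLabel_mul (g₁ g₂ : FreeGroup A) (x : FreeGroup A ⧸ K) :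
    pathLabel r (g₁ * g₂) x = pathLabel r g₁ (g₂ • x) * pathLabel r g₂ x := by
  rw [pathLabel, map_mul, Equiv.Perm.mul_apply, schreierAction_apply, schreierAction_apply]
  simp

theorem pathLabel_of (a : A) (x : FreeGroup A ⧸ K) :
    pathLabel r (FreeGroup.of a) x = schreierLabel r x a := by
  simp [pathLabel, schreierAction_of]

@[simp]
theorem pathLabel_one (x : FreeGroup A ⧸ K) : pathLabel r 1 x = 1 := by
  simp [pathLabel]

theorem pathLabel_inv (g : FreeGroup A) (x : FreeGroup A ⧸ K) :
    pathLabel r g⁻¹ x = (pathLabel r g (g⁻¹ • x))⁻¹ := by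
  rw [eq_inv_iff_mul_eq_one]
  have := pathLabel_mul r g⁻¹ g (g⁻¹ • x)
  simpa using this.symm

theorem lift_schreierLabel (x : FreeGroup A ⧸ K) (a : A) :
    FreeGroup.lift schreierGen (schreierLabel r x a) =
      (r (FreeGroup.of a • x))⁻¹ * (FreeGroup.of a * r x) := by
  unfold schreierLabel
  split_ifs with h
  · simp [schreierGen]
  · rw [not_not] at h
    simp [h]

/-- The product of the Schreier generators along a path telescopes; on loops at the trivial coset it
returns g itself once `r` is 1 there. -/
theorem lift_pathLabel (g : FreeGroup A) (x : FreeGroup A ⧸ K) :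
    FreeGroup.lift schreierGen (pathLabel r g x) = (r (g • x))⁻¹ * g * r x := by
  induction g using FreeGroup.induction_on generalizing x with
  | C1 => simp
  | of a => rw [pathLabel_of, lift_schreierLabel, mul_assoc]
  | inv_of a _ =>
    rw [pathLabel_inv, pathLabel_of, map_inv, lift_schreierLabel]
    simp [mul_assoc]
  | mul g₁ g₂ h₁ h₂ =>
    rw [pathLabel_mul, map_mul, h₁, h₂, mul_smul]
    group

/-- `r` is a Schreier transversal: each of its nontrivial values is the product of a letter and a
value of `r` of smaller rank. -/
structure IsSchreierTransversal : Prop where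
  mk_apply : ∀ x, (r x : FreeGroup A ⧸ K) = x
  exists_rank : ∃ l : FreeGroup A ⧸ K → ℕ, ∀ x,
    r x = 1 ∨ ∃ a y, l y < l x ∧ r x = FreeGroup.of a * r y

variable {r}

theorem IsSchreierTransversal.induction (hr : IsSchreierTransversal r)
    {P : FreeGroup A ⧸ K → Prop} (one : ∀ x, r x = 1 → P x)
    (of_mul : ∀ x a y, r x = FreeGroup.of a * r y → P y → P x) (x : FreeGroup A ⧸ K) : P x := by
  obtain ⟨l, hl⟩ := hr.exists_rank
  induction h : l x using Nat.strong_induction_on generalizing x with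
  | h n ih =>
    obtain h1 | ⟨a, y, hy, hxy⟩ := hl x
    · exact one x h1
    · exact of_mul x a y hxy (ih _ (h ▸ hy) y rfl)

/-- Descending in rank ends at a coset whose representative is 1, and such a coset is the trivial
one. -/
theorem IsSchreierTransversal.apply_one (hr : IsSchreierTransversal r) :
    r ((1 : FreeGroup A) : FreeGroup A ⧸ K) = 1 := by
  refine hr.induction (P := fun _ => r ((1 : FreeGroup A) : FreeGroup A ⧸ K) = 1)
    (fun x hx => ?_) (fun _ _ _ _ h => h) ((1 : FreeGroup A) : FreeGroup A ⧸ K)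
  rw [← hx, hr.mk_apply]

/-- Reading `r x` from the trivial coset uses only tree edges, whose labels are 1. -/
theorem IsSchreierTransversal.pathLabel_eq_one (hr : IsSchreierTransversal r)
    (x : FreeGroup A ⧸ K) : pathLabel r (r x) ((1 : FreeGroup A) : FreeGroup A ⧸ K) = 1 := by
  induction x using hr.induction with
  | one x hx => rw [hx, pathLabel_one]
  | of_mul x a y hxy ih =>
    have hy : FreeGroup.of a • y = x := by
      rw [← hr.mk_apply x, hxy, ← smul_eq_mul, ← MulAction.Quotient.smul_coe, hr.mk_apply]
    rw [hxy, pathLabel_mul, ih, mul_one, pathLabel_of, MulAction.Quotient.smul_coe, smul_eq_mul,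
      mul_one, hr.mk_apply, schreierLabel, dif_neg]
    rw [not_not, hy, hxy]

theorem schreierGen_mem (hr : IsSchreierTransversal r) (p : SchreierIndex r) :
    schreierGen p ∈ K := by
  rw [schreierGen, ← QuotientGroup.eq, hr.mk_apply, ← smul_eq_mul, ← MulAction.Quotient.smul_coe,
    hr.mk_apply]

/-- The Nielsen–Schreier theorem: the nontrivial Schreier generators of a subgroup of a free group
form a basis of it. -/
theorem isBasisOf_schreierGen (hr : IsSchreierTransversal r) :
    IsBasisOf (schreierGen (r := r)) K := by
  let o : FreeGroup A ⧸ K := (1 : FreeGroup A)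
  have ho (k : K) : (k : FreeGroup A) • o = o := by
    simp [o, QuotientGroup.eq]
  -- Elements of K are loops at the trivial coset, so on them the cocycle `pathLabel` is a
  -- homomorphism. It is shown inverse to the map θ evaluating Schreier generators.
  let ψ : K →* FreeGroup (SchreierIndex r) :=
    { toFun := fun k => pathLabel r k o
      map_one' := by simp
      map_mul' := fun k l => by simp [pathLabel_mul, ho] }
  let θ : FreeGroup (SchreierIndex r) →* K :=
    FreeGroup.lift fun p => ⟨schreierGen p, schreierGen_mem hr p⟩
  have hθ (h) : (θ h : FreeGroup A) = FreeGroup.lift schreierGen h := by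
    have : K.subtype.comp θ = FreeGroup.lift schreierGen := by
      ext p
      simp [θ]
    exact DFunLike.congr_fun this h
  have h1 : θ.comp ψ = MonoidHom.id K := by
    ext k
    have := lift_pathLabel r (k : FreeGroup A) o
    rw [ho, hr.apply_one] at this
    simpa [ψ, hθ] using this
  -- The loop of a Schreier generator goes to x in the tree, crosses the edge (x, a) and returns in
  -- the tree; only that edge contributes a label.
  have h2 : ψ.comp θ = MonoidHom.id _ := by
    ext p
    obtain ⟨⟨x, a⟩, h⟩ := p
    have hx : r x • o = x := by
      simpa [o, MulAction.Quotient.smul_coe] using hr.mk_apply x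
    have hax : (r (FreeGroup.of a • x))⁻¹ • (FreeGroup.of a • x) = o := by
      rw [inv_smul_eq_iff]
      simpa [o, MulAction.Quotient.smul_coe] using (hr.mk_apply (FreeGroup.of a • x)).symm
    have : pathLabel r (schreierGen ⟨(x, a), h⟩) o = FreeGroup.of ⟨(x, a), h⟩ := by
      rw [schreierGen, pathLabel_mul, pathLabel_mul, hr.pathLabel_eq_one, mul_smul, hx,
        pathLabel_of, pathLabel_inv, hax, hr.pathLabel_eq_one, schreierLabel, dif_pos h]
      simp
    simpa [ψ, θ] using this
  exact ⟨⟨MonoidHom.toMulEquiv ψ θ h1 h2⟩, fun p => by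
    change ((θ (FreeGroup.of p) : K) : FreeGroup A) = _
    simp [θ]⟩

theorem IsBasisOf.reindex {ι ι' : Type*} {G : Type u} [Group G] {x : ι → G} {K : Subgroup G}
    (h : IsBasisOf x K) (e : ι' ≃ ι) : IsBasisOf (fun i => x (e i)) K := by
  obtain ⟨b, hb⟩ := h
  exact ⟨b.reindex e.symm, fun i => by simp [hb]⟩

theorem IsBasisOf.injective {ι : Type*} {G : Type u} [Group G] {x : ι → G} {K : Subgroup G}
    (h : IsBasisOf x K) : Function.Injective x := by
  obtain ⟨b, hb⟩ := h
  intro i j hij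
  rw [← hb, ← hb, Subtype.coe_inj] at hij
  exact b.injective hij

theorem IsBasisOf.closure_range {ι : Type*} {G : Type u} [Group G] {x : ι → G} {K : Subgroup G}
    (h : IsBasisOf x K) : Subgroup.closure (Set.range x) = K := by
  obtain ⟨b, hb⟩ := h
  refine le_antisymm ((Subgroup.closure_le _).2 ?_) fun g hg => ?_
  · rintro _ ⟨i, rfl⟩
    exact hb i ▸ (b i).2
  · have : g = (b.repr.symm (b.repr ⟨g, hg⟩) : K) := by simp
    rw [this]
    induction b.repr ⟨g, hg⟩ using FreeGroup.induction_on with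
    | C1 => simp
    | of i => exact Subgroup.subset_closure ⟨i, (hb i).symm⟩
    | inv_of i h => simpa using h
    | mul _ _ h₁ h₂ => simpa using mul_mem h₁ h₂

end Schreier

/-! ### Words, the word problem and membership in the closure -/

section Words

/-- Whether the number `k` refers to a letter of an alphabet of the given size. -/
def IsLetter (s : Option ℕ) (k : ℕ) : Prop := ∀ n ∈ s, k < n

instance (s : Option ℕ) (k : ℕ) : Decidable (IsLetter s k) := by
  cases s <;> simp only [IsLetter] <;> infer_instance

/-- The word obtained by deleting the numbers which refer to no letter. -/
def restrictWord (s : Option ℕ) (w : Word) : Word := w.filter fun p => IsLetter s p.1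

/-- Equality of the elements represented by two words. -/
def WordEq (s : Option ℕ) (v w : Word) : Prop :=
  FreeGroup.reduce (restrictWord s v) = FreeGroup.reduce (restrictWord s w)

/-- Triviality of the exponent sums, modulo `m`, of a word. -/
def HasTrivialExpSum (s : Option ℕ) (m : ℕ) (w : Word) : Prop :=
  ∀ p ∈ w, IsLetter s p.1 → w.count (p.1, true) % m = w.count (p.1, false) % m

/-- Words representing all elements of the subgroup generated by `L`, modulo commutators and
`m`-th powers. -/
def combinations (m : ℕ) (L : List Word) : List Word :=
  L.foldr (fun v W => (List.range m).flatMap fun j => W.map fun u => (v ++ ·)^[j] u) [[]]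

/-- Membership of a word in the closure. -/
def MemClosure (I : Input) (w : Word) : Prop :=
  ∃ u ∈ combinations I.2.1 I.2.2, HasTrivialExpSum I.1 I.2.1 (FreeGroup.invRev u ++ w)

theorem evalWord_append {ι : Type v} {G : Type u} [Group G] (x : ι → G) (v w : List (ι × Bool)) :
    evalWord x (v ++ w) = evalWord x v * evalWord x w := by
  simp [evalWord]

theorem evalWord_cons {ι : Type v} {G : Type u} [Group G] (x : ι → G) (p : ι × Bool)
    (w : List (ι × Bool)) :
    evalWord x (p :: w) = (if p.2 then x p.1 else (x p.1)⁻¹) * evalWord x w := by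
  simp [evalWord]

theorem evalWord_eq_lift {ι : Type v} {G : Type u} [Group G] (x : ι → G) (w : List (ι × Bool)) :
    evalWord x w = FreeGroup.lift x (FreeGroup.mk w) := by
  simp [evalWord, FreeGroup.lift_mk, Bool.cond_eq_ite]

theorem evalWord_mem {ι : Type v} {G : Type u} [Group G] {x : ι → G} {w : List (ι × Bool)}
    {K : Subgroup G} (h : ∀ p ∈ w, x p.1 ∈ K) : evalWord x w ∈ K := by
  refine list_prod_mem fun g hg => ?_
  obtain ⟨p, hp, rfl⟩ := List.mem_map.1 hg
  split_ifs
  exacts [h p hp, inv_mem (h p hp)]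

/-- The elements of a subgroup generated by a family are represented by words in the family. -/
theorem exists_evalWord_eq {ι : Type v} {G : Type u} [Group G] {x : ι → G} {s : Set ι} {g : G}
    (h : g ∈ Subgroup.closure (x '' s)) :
    ∃ w : List (ι × Bool), (∀ p ∈ w, p.1 ∈ s) ∧ evalWord x w = g := by
  induction h using Subgroup.closure_induction with
  | mem g hg =>
    obtain ⟨i, hi, rfl⟩ := hg
    exact ⟨[(i, true)], by simpa using hi, by simp [evalWord]⟩
  | one => exact ⟨[], by simp, by simp [evalWord]⟩
  | mul g h _ _ ihg ihh =>
    obtain ⟨v, hv, rfl⟩ := ihg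
    obtain ⟨w, hw, rfl⟩ := ihh
    refine ⟨v ++ w, fun p hp => ?_, evalWord_append x v w⟩
    exact (List.mem_append.1 hp).elim (hv p) (hw p)
  | inv g _ ih =>
    obtain ⟨w, hw, rfl⟩ := ih
    refine ⟨FreeGroup.invRev w, fun p hp => ?_, ?_⟩
    · simp only [FreeGroup.invRev, List.mem_reverse, List.mem_map] at hp
      obtain ⟨q, hq, rfl⟩ := hp
      exact hw q hq
    · rw [evalWord_eq_lift, evalWord_eq_lift, ← FreeGroup.inv_mk, map_inv]

namespace Naming

variable {A : Type u} (ν : Naming A)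

@[simp]
theorem elt_nil : ν.elt [] = 1 := by simp [elt, evalWord]

theorem elt_append (v w : Word) : ν.elt (v ++ w) = ν.elt v * ν.elt w := evalWord_append _ _ _

theorem elt_cons (p : ℕ × Bool) (w : Word) :
    ν.elt (p :: w) = (if p.2 then ν.gen p.1 else (ν.gen p.1)⁻¹) * ν.elt w := evalWord_cons _ _ _

theorem elt_eq_lift (w : Word) : ν.elt w = FreeGroup.lift ν.gen (FreeGroup.mk w) :=
  evalWord_eq_lift _ _

theorem elt_invRev (w : Word) : ν.elt (FreeGroup.invRev w) = (ν.elt w)⁻¹ := by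
  rw [elt_eq_lift, elt_eq_lift, ← FreeGroup.inv_mk, map_inv]

theorem elt_invRev_append (v w : Word) :
    ν.elt (FreeGroup.invRev v ++ w) = (ν.elt v)⁻¹ * ν.elt w := by
  rw [elt_append, elt_invRev]

theorem gen_eq_one {k : ℕ} (h : ¬ IsLetter ν.size k) : ν.gen k = 1 := by
  cases ν <;> simp_all [IsLetter, size, gen]

theorem exists_gen_eq_of {k : ℕ} (h : IsLetter ν.size k) :
    ∃ a, ν.gen k = FreeGroup.of a := by
  cases ν <;> simp_all [IsLetter, size, gen]

theorem gen_inj {k l : ℕ} (hk : IsLetter ν.size k) (hl : IsLetter ν.size l)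
    (h : ν.gen k = ν.gen l) : k = l := by
  cases ν with
  | finite n e => simpa [gen, show k < n from hk n rfl, show l < n from hl n rfl,
      FreeGroup.of_injective.eq_iff] using h
  | infinite e => simpa [gen, FreeGroup.of_injective.eq_iff] using h

theorem elt_restrictWord (w : Word) : ν.elt (restrictWord ν.size w) = ν.elt w := by
  induction w with
  | nil => rfl
  | cons p w ih =>
    by_cases hp : IsLetter ν.size p.1
    · rw [restrictWord, List.filter_cons_of_pos (by simpa using hp), elt_cons, elt_cons, ← ih]
      rfl
    · rw [restrictWord, List.filter_cons_of_neg (by simpa using hp), elt_cons,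
        ν.gen_eq_one hp, ← ih]
      simp [restrictWord]

/-- Renaming letters by their numbers recovers the reduced word from the element, which reduces
equality over any alphabet to free reduction over ℕ. Unnumbered letters of an infinite alphabet go
to arbitrary generators. -/
theorem exists_hom_elt :
    ∃ ρ : FreeGroup A →* FreeGroup ℕ, ∀ w, ρ (ν.elt w) = FreeGroup.mk (restrictWord ν.size w) := by
  have key (ρ : FreeGroup A →* FreeGroup ℕ) (hρ : ∀ k, IsLetter ν.size k →
      ρ (ν.gen k) = FreeGroup.of k) (w) :
      ρ (ν.elt w) = FreeGroup.mk (restrictWord ν.size w) := by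
    induction w with
    | nil => rw [elt_nil, map_one]; rfl
    | cons p w ih =>
      rw [elt_cons, map_mul, ih]
      by_cases hp : IsLetter ν.size p.1
      · rw [restrictWord, restrictWord, List.filter_cons_of_pos (by simpa using hp),
          ← List.singleton_append, ← FreeGroup.mul_mk]
        congr 1
        obtain ⟨k, b⟩ := p
        cases b
        · simp [hρ k hp, FreeGroup.of, FreeGroup.inv_mk, FreeGroup.invRev]
        · simp [hρ k hp, FreeGroup.of]
      · rw [restrictWord, restrictWord, List.filter_cons_of_neg (by simpa using hp),
          ν.gen_eq_one hp]
        simp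
  cases ν with
  | finite n e =>
    exact ⟨FreeGroup.map fun a => (e.symm a : ℕ), key _ fun k hk => by
      simp [gen, show k < n from hk n rfl]⟩
  | infinite e =>
    exact ⟨FreeGroup.map (Function.invFun e), key _ fun k _ => by
      simp [gen, Function.leftInverse_invFun e.injective k]⟩

theorem elt_eq_elt_iff {v w : Word} : ν.elt v = ν.elt w ↔ WordEq ν.size v w := by
  refine ⟨fun h => ?_, fun h => ?_⟩
  · obtain ⟨ρ, hρ⟩ := ν.exists_hom_elt
    exact FreeGroup.reduce.sound (by rw [← hρ, ← hρ, h])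
  · rw [← ν.elt_restrictWord v, ← ν.elt_restrictWord w, elt_eq_lift, elt_eq_lift,
      FreeGroup.reduce.exact h]

theorem fg_subgroup (L : List Word) : (ν.subgroup L).FG :=
  (Subgroup.fg_iff _).2 ⟨_, rfl, (List.finite_toSet (L.map ν.elt)).subset <| by
    rintro _ ⟨w, hw, rfl⟩
    exact List.mem_map_of_mem hw⟩

theorem elt_mem_subgroup {L : List Word} {w : Word} (h : w ∈ L) : ν.elt w ∈ ν.subgroup L :=
  Subgroup.subset_closure ⟨w, h, rfl⟩

theorem expSum_gen (m : ℕ) {a : A} {k : ℕ} (hk : IsLetter ν.size k)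
    (ha : ν.gen k = FreeGroup.of a) (l : ℕ) :
    (expSum m (ν.gen l)).toAdd a = if l = k then 1 else 0 := by
  classical
  by_cases hl : IsLetter ν.size l
  · obtain ⟨b, hb⟩ := ν.exists_gen_eq_of hl
    have : b = a ↔ l = k := by
      refine ⟨fun h => ν.gen_inj hl hk (by rw [ha, hb, h]), fun h => ?_⟩
      rw [h, ha] at hb
      exact FreeGroup.of_injective hb.symm
    simp [hb, Finsupp.single_apply, this]
  · have : l ≠ k := fun h => hl (h ▸ hk)
    simp [ν.gen_eq_one hl, this]

theorem expSum_elt (m : ℕ) {a : A} {k : ℕ} (hk : IsLetter ν.size k)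
    (ha : ν.gen k = FreeGroup.of a) (w : Word) :
    (expSum m (ν.elt w)).toAdd a = w.count (k, true) - w.count (k, false) := by
  induction w with
  | nil => simp
  | cons p w ih =>
    obtain ⟨l, b⟩ := p
    rw [elt_cons, map_mul, toAdd_mul, Finsupp.add_apply, ih, List.count_cons, List.count_cons]
    have := ν.expSum_gen m hk ha l
    cases b <;> by_cases h : l = k <;> simp_all <;> ring

theorem expSum_elt_of_forall_ne (m : ℕ) {a : A} (ha : ∀ k, ν.gen k ≠ FreeGroup.of a) (w : Word) :
    (expSum m (ν.elt w)).toAdd a = 0 := by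
  classical
  induction w with
  | nil => simp
  | cons p w ih =>
    have : (expSum m (ν.gen p.1)).toAdd a = 0 := by
      by_cases hl : IsLetter ν.size p.1
      · obtain ⟨b, hb⟩ := ν.exists_gen_eq_of hl
        have : b ≠ a := fun h => ha p.1 (h ▸ hb)
        simp [hb, this]
      · simp [ν.gen_eq_one hl]
    rw [elt_cons, map_mul, toAdd_mul, Finsupp.add_apply, ih]
    split_ifs <;> simp [this]

theorem elt_mem_abVerbal_iff {m : ℕ} {w : Word} :
    ν.elt w ∈ abVerbal (FreeGroup A) m ↔ HasTrivialExpSum ν.size m w := by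
  rw [← ker_expSum, MonoidHom.mem_ker, ← toAdd_eq_zero, Finsupp.ext_iff]
  have key {k : ℕ} {a : A} (hk : IsLetter ν.size k) (ha : ν.gen k = FreeGroup.of a) :
      (expSum m (ν.elt w)).toAdd a = 0 ↔ w.count (k, true) % m = w.count (k, false) % m := by
    rw [ν.expSum_elt m hk ha, sub_eq_zero, ZMod.natCast_eq_natCast_iff']
  refine ⟨fun h p _ hp => ?_, fun h a => ?_⟩
  · obtain ⟨a, ha⟩ := ν.exists_gen_eq_of hp
    exact (key hp ha).1 (h a)
  · by_cases hk : ∃ k, ν.gen k = FreeGroup.of a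
    · obtain ⟨k, hk⟩ := hk
      have hk' : IsLetter ν.size k := by
        by_contra hk'
        exact FreeGroup.of_ne_one a (hk.symm.trans (ν.gen_eq_one hk'))
      -- The test inspects only letters occurring in w; for any other letter both counts are 0.
      refine (key hk' hk).2 ?_
      by_cases h1 : (k, true) ∈ w
      · exact h _ h1 hk'
      by_cases h2 : (k, false) ∈ w
      · exact h _ h2 hk'
      rw [List.count_eq_zero_of_not_mem h1, List.count_eq_zero_of_not_mem h2]
    · exact ν.expSum_elt_of_forall_ne m (not_exists.1 hk) w

theorem elt_iterate_append (v u : Word) (j : ℕ) :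
    ν.elt ((v ++ ·)^[j] u) = ν.elt v ^ j * ν.elt u := by
  induction j with
  | zero => simp
  | succ j ih => rw [Function.iterate_succ_apply', elt_append, ih, pow_succ', mul_assoc]

theorem elt_mem_subgroup_of_mem_combinations {m : ℕ} {L : List Word} {u : Word}
    (h : u ∈ combinations m L) : ν.elt u ∈ ν.subgroup L := by
  induction L generalizing u with
  | nil =>
    obtain rfl : u = [] := by simpa [combinations] using h
    simp
  | cons v L ih =>
    simp only [combinations, List.foldr_cons, List.mem_flatMap, List.mem_map] at h
    obtain ⟨j, -, x, hx, rfl⟩ := h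
    rw [elt_iterate_append]
    refine mul_mem (pow_mem (ν.elt_mem_subgroup List.mem_cons_self) j) ?_
    refine Subgroup.closure_mono ?_ (ih hx)
    rintro _ ⟨w, hw, rfl⟩
    exact ⟨w, List.mem_cons_of_mem v hw, rfl⟩

/-- Modulo F'F^m the generators commute and have order dividing m, so their powers can be collected
and the exponents reduced to the range 0, …, m - 1. -/
theorem exists_mem_combinations {m : ℕ} (hm : 1 ≤ m) {L : List Word} {g : FreeGroup A}
    (h : g ∈ ν.subgroup L) :
    ∃ u ∈ combinations m L, (ν.elt u : FreeGroup A ⧸ abVerbal (FreeGroup A) m) = g := by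
  let _ : CommGroup (FreeGroup A ⧸ abVerbal (FreeGroup A) m) :=
    { mul_comm := quotient_mul_comm le_rfl }
  let φ := QuotientGroup.mk' (abVerbal (FreeGroup A) m)
  suffices ∀ q ∈ Subgroup.closure {q | ∃ w ∈ L, φ (ν.elt w) = q},
      ∃ u ∈ combinations m L, φ (ν.elt u) = q by
    refine this (φ g) ?_
    have h' := Subgroup.mem_map_of_mem φ h
    rw [subgroup, MonoidHom.map_closure] at h'
    refine Subgroup.closure_mono ?_ h'
    rintro _ ⟨_, ⟨w, hw, rfl⟩, rfl⟩
    exact ⟨w, hw, rfl⟩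
  clear h
  induction L with
  | nil => simp +contextual [combinations]
  | cons v L ih =>
    intro q hq
    have hS : {q | ∃ w ∈ v :: L, φ (ν.elt w) = q} =
        {φ (ν.elt v)} ∪ {q | ∃ w ∈ L, φ (ν.elt w) = q} := by
      ext q
      simp [eq_comm]
    rw [hS, Subgroup.closure_union, Subgroup.mem_sup] at hq
    obtain ⟨x, hx, y, hy, rfl⟩ := hq
    obtain ⟨z, rfl⟩ := Subgroup.mem_closure_singleton.1 hx
    obtain ⟨u, hu, rfl⟩ := ih y hy
    have hz : (0 : ℤ) ≤ z % m := Int.emod_nonneg _ (by lia)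
    refine ⟨(v ++ ·)^[(z % m).toNat] u, ?_, ?_⟩
    · simp only [combinations, List.foldr_cons, List.mem_flatMap, List.mem_map, List.mem_range]
      have := Int.emod_lt_of_pos z (b := m) (by lia)
      exact ⟨_, by lia, u, hu, rfl⟩
    · rw [elt_iterate_append, map_mul, map_pow]
      congr 1
      rw [← zpow_natCast, Int.toNat_of_nonneg hz]
      conv_rhs => rw [← Int.mul_ediv_add_emod z m, zpow_add, zpow_mul, zpow_natCast,
        quotient_pow_eq_one le_rfl, one_zpow, one_mul]

theorem memClosure_iff_mem_sup {m : ℕ} (hm : 1 ≤ m) {L : List Word} {w : Word} :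
    MemClosure (ν.size, m, L) w ↔ ν.elt w ∈ ν.subgroup L ⊔ abVerbal (FreeGroup A) m := by
  simp only [MemClosure, ← ν.elt_mem_abVerbal_iff, elt_invRev_append]
  refine ⟨fun ⟨u, hu, h⟩ => ?_, fun h => ?_⟩
  · rw [← mul_inv_cancel_left (ν.elt u) (ν.elt w)]
    exact Subgroup.mul_mem_sup (ν.elt_mem_subgroup_of_mem_combinations hu) h
  · obtain ⟨g, hg, n, hn, hgn⟩ := Subgroup.mem_sup_of_normal_right.1 h
    obtain ⟨u, hu, hug⟩ := ν.exists_mem_combinations hm hg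
    refine ⟨u, hu, QuotientGroup.eq.1 (hug.trans ?_)⟩
    rw [QuotientGroup.eq, ← hgn]
    simpa using hn

theorem memClosure_iff {m : ℕ} (hm : 1 ≤ m) {L : List Word} {w : Word} :
    MemClosure (ν.size, m, L) w ↔ ν.elt w ∈ proClosure (Ab m) (ν.subgroup L) := by
  rw [proClosure_ab hm, memClosure_iff_mem_sup ν hm]

end Naming

end Words

/-! ### Schreier transversals of the closure as lists of words -/

section Transversal

/-- The list `T` of positive words, closed under removing the first letter, represents each coset
of the closure exactly once. -/
def IsTransversal (I : Input) (T : List Word) : Prop :=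
  [] ∈ T ∧
  (∀ t ∈ T, t.tail ∈ T ∧ ∀ p ∈ t, p.1 < I.1.getD 0 ∧ p.2 = true) ∧
  (∀ k < I.1.getD 0, ∀ t ∈ T, ∃ u ∈ T, MemClosure I (FreeGroup.invRev u ++ (k, true) :: t)) ∧
  ∀ j < T.length, ∀ i < j, ¬ MemClosure I (FreeGroup.invRev (T.getD i []) ++ T.getD j [])

open Classical in
/-- The word in the list `T` which represents the coset of `w`. -/
noncomputable def cosetRep (I : Input) (T : List Word) (w : Word) : Word :=
  T.getD (T.findIdx fun t => MemClosure I (FreeGroup.invRev t ++ w)) []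

open Classical in
/-- The pairs of an element of the transversal and a letter giving nontrivial generators. -/
noncomputable def basisPairs (I : Input) (T : List Word) : List (Word × ℕ) :=
  (T ×ˢ List.range (I.1.getD 0)).filter fun q =>
    ¬ WordEq I.1 (cosetRep I T ((q.2, true) :: q.1)) ((q.2, true) :: q.1)

/-- The words representing the nontrivial Schreier generators. -/
noncomputable def basisWords (I : Input) (T : List Word) : List Word :=
  (basisPairs I T).map fun q =>
    FreeGroup.invRev (cosetRep I T ((q.2, true) :: q.1)) ++ (q.2, true) :: q.1

theorem cosetRep_spec {I : Input} {T : List Word} {w : Word}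
    (h : ∃ t ∈ T, MemClosure I (FreeGroup.invRev t ++ w)) :
    cosetRep I T w ∈ T ∧ MemClosure I (FreeGroup.invRev (cosetRep I T w) ++ w) := by
  classical
  have hlt : T.findIdx (fun t => MemClosure I (FreeGroup.invRev t ++ w)) < T.length := by
    rw [List.findIdx_lt_length]
    simpa using h
  rw [cosetRep, List.getD_eq_getElem _ _ hlt]
  exact ⟨List.getElem_mem hlt, by simpa using List.findIdx_getElem (w := hlt)⟩

theorem IsBasisOf.map_list {α : Type*} {G : Type u} [Group G] {x : Word → G} {K : Subgroup G}
    {l : List α} (hl : l.Nodup) (g : α → Word)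
    (h : IsBasisOf (fun p : {p // p ∈ l} => x (g p)) K) :
    IsBasisOf (fun i : Fin (l.map g).length => x ((l.map g).get i)) K := by
  classical
  have := h.reindex ((finCongr (by simp)).trans (List.Nodup.getEquiv l hl) :
    Fin (l.map g).length ≃ {p // p ∈ l})
  convert this using 2 with i
  simp

variable {A : Type u} {n m : ℕ} {e : Fin n ≃ A} {L T : List Word}

namespace Naming

/-- The closure described by an input. -/
abbrev closed (ν : Naming A) (m : ℕ) (L : List Word) : Subgroup (FreeGroup A) :=
  proClosure (Ab m) (ν.subgroup L)

theorem memClosure_invRev_append_iff (ν : Naming A) (hm : 1 ≤ m) {v w : Word} :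
    MemClosure (ν.size, m, L) (FreeGroup.invRev v ++ w) ↔
      (ν.elt v : FreeGroup A ⧸ ν.closed m L) = ν.elt w := by
  rw [ν.memClosure_iff hm, elt_invRev_append, QuotientGroup.eq]

theorem finiteIndex_closed (ν : Naming A) [Finite A] (hm : 1 ≤ m) :
    (ν.closed m L).FiniteIndex := by
  rw [closed, proClosure_ab hm]
  exact finiteIndex_of_abVerbal_le hm le_sup_right

theorem gen_finite (k : Fin n) : (finite n e).gen k = FreeGroup.of (e k) := by
  simp [gen]

end Naming

section

variable (hm : 1 ≤ m) (hT : IsTransversal (some n, m, L) T)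
include hm hT

theorem IsTransversal.pairwise : T.Pairwise fun u v =>
    ((Naming.finite n e).elt u : FreeGroup A ⧸ (Naming.finite n e).closed m L) ≠
      (Naming.finite n e).elt v := by
  rw [List.pairwise_iff_getElem]
  intro i j hi hj hij
  rw [Ne, ← Naming.memClosure_invRev_append_iff _ hm]
  have := hT.2.2.2 j hj i hij
  rwa [List.getD_eq_getElem _ _ hi, List.getD_eq_getElem _ _ hj] at this

theorem IsTransversal.inj {u v : Word} (hu : u ∈ T) (hv : v ∈ T)
    (h : ((Naming.finite n e).elt u : FreeGroup A ⧸ (Naming.finite n e).closed m L) =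
      (Naming.finite n e).elt v) : u = v := by
  obtain ⟨i, hi, rfl⟩ := List.getElem_of_mem hu
  obtain ⟨j, hj, rfl⟩ := List.getElem_of_mem hv
  have hT := List.pairwise_iff_getElem.1 (hT.pairwise hm (e := e))
  rcases lt_trichotomy i j with hij | rfl | hij
  · exact absurd h (hT i j hi hj hij)
  · rfl
  · exact absurd h.symm (hT j i hj hi hij)

theorem IsTransversal.nodup : T.Nodup :=
  by
  refine (hT.pairwise hm (e := Equiv.refl _)).imp fun h h' => h ?_
  rw [h']

theorem IsTransversal.exists_mem (x : FreeGroup A ⧸ (Naming.finite n e).closed m L) :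
    ∃ t ∈ T, ((Naming.finite n e).elt t : FreeGroup A ⧸ (Naming.finite n e).closed m L) = x := by
  let P (x : FreeGroup A ⧸ (Naming.finite n e).closed m L) : Prop :=
    ∃ t ∈ T, ((Naming.finite n e).elt t : FreeGroup A ⧸ (Naming.finite n e).closed m L) = x
  have hof (a : A) (x) (hx : P x) : P (FreeGroup.of a • x) := by
    obtain ⟨t, ht, rfl⟩ := hx
    obtain ⟨k, rfl⟩ := e.surjective a
    obtain ⟨u, hu, h⟩ := hT.2.2.1 k k.2 t ht
    refine ⟨u, hu, ((Naming.finite n e).memClosure_invRev_append_iff hm).1 h |>.trans ?_⟩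
    rw [Naming.elt_cons, MulAction.Quotient.smul_coe, smul_eq_mul, Naming.gen_finite, if_pos rfl]
  have hpow (a : A) (j : ℕ) (x) (hx : P x) : P (FreeGroup.of a ^ j • x) := by
    induction j with
    | zero => simpa using hx
    | succ j ih => simpa [pow_succ', mul_smul] using hof a _ ih
  have hle : abVerbal (FreeGroup A) m ≤ (Naming.finite n e).closed m L := by
    rw [Naming.closed, proClosure_ab hm]
    exact le_sup_right
  -- Positive letters suffice: a^m acts trivially on the cosets because the closure contains the
  -- normal subgroup F'F^m, so a⁻¹ acts as a^(m - 1).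
  have hinv (a : A) (x) (hx : P x) : P ((FreeGroup.of a)⁻¹ • x) := by
    have : (FreeGroup.of a)⁻¹ • x = FreeGroup.of a ^ (m - 1) • x := by
      rw [inv_smul_eq_iff, smul_smul, ← pow_succ', Nat.sub_add_cancel hm]
      induction x using QuotientGroup.induction_on with | H g => ?_
      rw [MulAction.Quotient.smul_coe, QuotientGroup.eq, smul_eq_mul]
      apply hle
      have := (normal_abVerbal (FreeGroup A) m).conj_mem _
        (pow_mem_abVerbal (m := m) (FreeGroup.of a)) g⁻¹
      simpa [mul_assoc] using this
    rw [this]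
    exact hpow a _ x hx
  have key (g : FreeGroup A) (x) (hx : P x) : P (g • x) := by
    induction g using FreeGroup.induction_on generalizing x with
    | C1 => simpa using hx
    | of a => exact hof a x hx
    | inv_of a _ => exact hinv a x hx
    | mul g h hg hh => rw [mul_smul]; exact hg _ (hh _ hx)
  induction x using QuotientGroup.induction_on with | H g => ?_
  simpa [MulAction.Quotient.smul_coe] using key g (1 : FreeGroup A) ⟨[], hT.1, by simp⟩

/-- The list T gives a Schreier transversal of the closure, and the listed pairs of a word and a
letter number correspond bijectively to its nontrivial Schreier generators. -/
theorem IsTransversal.isBasisOf :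
    IsBasisOf (fun i : Fin (basisWords (some n, m, L) T).length =>
      (Naming.finite n e).elt ((basisWords (some n, m, L) T).get i))
      ((Naming.finite n e).closed m L) := by
  set ν := Naming.finite n e with hν
  choose τ hτ hmk using hT.exists_mem hm (e := e)
  let r (x : FreeGroup A ⧸ ν.closed m L) : FreeGroup A := ν.elt (τ x)
  have hτt {t : Word} (ht : t ∈ T) : τ (ν.elt t) = t := hT.inj hm (hτ _) ht (hmk _)
  have hrep (w : Word) : cosetRep (some n, m, L) T w = τ (ν.elt w) := by
    have hiff (t : Word) : MemClosure (some n, m, L) (FreeGroup.invRev t ++ w) ↔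
        (ν.elt t : FreeGroup A ⧸ ν.closed m L) = ν.elt w := ν.memClosure_invRev_append_iff hm
    obtain ⟨h1, h2⟩ := cosetRep_spec (I := (some n, m, L)) (T := T) (w := w)
      ⟨_, hτ (ν.elt w), (hiff _).2 (hmk _)⟩
    exact hT.inj hm h1 (hτ _) (((hiff _).1 h2).trans (hmk _).symm)
  have hgen (k : Fin n) (t : Word) :
      ν.elt (((k : ℕ), true) :: t) = FreeGroup.of (e k) * ν.elt t := by
    rw [Naming.elt_cons, if_pos rfl, Naming.gen_finite]
  have hr : IsSchreierTransversal r := by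
    -- The rank is word length: the tail of a word in T is in T, hence is the chosen representative
    -- of its own coset.
    refine ⟨hmk, fun x => (τ x).length, fun x => ?_⟩
    rcases h : τ x with - | ⟨⟨k, b⟩, t⟩
    · left
      simp [r, h]
    · right
      obtain ⟨ht, hx⟩ := hT.2.1 _ (h ▸ hτ x)
      rw [List.tail_cons] at ht
      obtain ⟨hk, rfl : b = true⟩ := hx (k, b) List.mem_cons_self
      refine ⟨e ⟨k, hk⟩, (ν.elt t : FreeGroup A), ?_, ?_⟩
      · change (τ (ν.elt t)).length < (τ x).length
        rw [hτt ht, h, List.length_cons]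
        exact Nat.lt_succ_self _
      · simp only [r]
        rw [h, hτt ht]
        exact hgen ⟨k, hk⟩ t
  have hmem (q : Word × ℕ) : q ∈ basisPairs (some n, m, L) T ↔ (q.1 ∈ T ∧ q.2 < n) ∧
      ν.elt (τ (ν.elt ((q.2, true) :: q.1))) ≠ ν.elt ((q.2, true) :: q.1) := by
    simp only [basisPairs, List.mem_filter, hrep, Option.getD_some, decide_eq_true_eq, Ne,
      ν.elt_eq_elt_iff]
    rw [← List.mem_range, ← List.mem_product]
    rfl
  have hsmul (k : Fin n) (t : Word) : FreeGroup.of (e k) • (ν.elt t : FreeGroup A ⧸ ν.closed m L) =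
      (ν.elt (((k : ℕ), true) :: t) : FreeGroup A) := by
    rw [hgen, MulAction.Quotient.smul_coe, smul_eq_mul]
  let f (q : {q // q ∈ basisPairs (some n, m, L) T}) : SchreierIndex r :=
    ⟨((ν.elt q.1.1 : FreeGroup A), e ⟨q.1.2, ((hmem q).1 q.2).1.2⟩), by
      obtain ⟨⟨t, k⟩, hq⟩ := q
      obtain ⟨⟨ht, hk⟩, hne⟩ := (hmem _).1 hq
      have := hsmul ⟨k, hk⟩ t
      simp only [r]
      rw [this, hτt ht, ← hgen]
      exact hne⟩
  have hf : Function.Bijective f := by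
    constructor
    · rintro ⟨⟨t, k⟩, hq⟩ ⟨⟨t', k'⟩, hq'⟩ h
      simp only [f, Subtype.mk.injEq, Prod.mk.injEq, EmbeddingLike.apply_eq_iff_eq,
        Fin.mk.injEq] at h
      obtain rfl := hT.inj hm ((hmem _).1 hq).1.1 ((hmem _).1 hq').1.1 h.1
      obtain rfl := h.2
      rfl
    · rintro ⟨⟨x, a⟩, h⟩
      obtain ⟨k, rfl⟩ := e.surjective a
      refine ⟨⟨(τ x, k), (hmem _).2 ⟨⟨hτ x, k.2⟩, ?_⟩⟩, ?_⟩
      · have hx := hsmul k (τ x)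
        rw [hmk x] at hx
        rw [hx, ← hgen] at h
        exact h
      · simp only [f, Subtype.mk.injEq, Prod.mk.injEq, and_true]
        exact hmk x
  have hnodup : (basisPairs (some n, m, L) T).Nodup :=
    ((hT.nodup hm).product List.nodup_range).filter _
  refine IsBasisOf.map_list hnodup _ ?_
  convert (isBasisOf_schreierGen hr).reindex (Equiv.ofBijective f hf) using 2 with q
  obtain ⟨⟨t, k⟩, hq⟩ := q
  obtain ⟨⟨ht, hk⟩, hne⟩ := (hmem _).1 hq
  have := hsmul ⟨k, hk⟩ t
  simp only [Equiv.ofBijective_apply, schreierGen, f, r]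
  rw [this, hτt ht, ← hgen, hrep, Naming.elt_invRev_append]

end

/-- Take a longest tail-closed list of positive words in distinct cosets; its length is bounded by
the finite index. If the coset of a letter times a listed word were missed, that product could be
added to the list. -/
theorem exists_isTransversal (n : ℕ) (hm : 1 ≤ m) (L : List Word) :
    ∃ T, IsTransversal (some n, m, L) T := by
  let ν := Naming.finite n (Equiv.refl (Fin n))
  have hiff (u v : Word) : MemClosure (some n, m, L) (FreeGroup.invRev u ++ v) ↔
      (ν.elt u : FreeGroup (Fin n) ⧸ ν.closed m L) = ν.elt v :=
    ν.memClosure_invRev_append_iff hm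
  have := ν.finiteIndex_closed hm (L := L)
  let good (T : List Word) : Prop := [] ∈ T ∧
    (∀ t ∈ T, t.tail ∈ T ∧ ∀ p ∈ t, p.1 < n ∧ p.2 = true) ∧
    T.Pairwise fun u v => (ν.elt u : FreeGroup (Fin n) ⧸ ν.closed m L) ≠ ν.elt v
  have hbound (T : List Word) (hT : good T) : T.length ≤ (ν.closed m L).index := by
    rw [Subgroup.index, ← Nat.card_fin T.length]
    refine Nat.card_le_card_of_injective
      (fun i => (ν.elt T[i] : FreeGroup (Fin n) ⧸ ν.closed m L)) fun i j hij => ?_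
    by_contra h
    have := List.pairwise_iff_getElem.1 hT.2.2
    rcases lt_or_gt_of_ne h with h | h
    · exact this i j _ _ h hij
    · exact this j i _ _ h hij.symm
  classical
  have hone : good [[]] := by simp [good]
  obtain ⟨T, hT, hlen⟩ := Nat.findGreatest_spec (P := fun l => ∃ T, good T ∧ T.length = l)
    (hbound [[]] hone) ⟨_, hone, rfl⟩
  refine ⟨T, hT.1, hT.2.1, fun k hk t ht => ?_, fun j hj i hij => ?_⟩
  · by_contra! h
    have hgood : good (((k, true) :: t) :: T) := by
      refine ⟨List.mem_cons_of_mem _ hT.1, fun u hu => ?_, List.pairwise_cons.2 ⟨?_, hT.2.2⟩⟩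
      · rcases List.mem_cons.1 hu with rfl | hu
        · refine ⟨List.mem_cons_of_mem _ ht, fun p hp => ?_⟩
          rcases List.mem_cons.1 hp with rfl | hp
          exacts [⟨hk, rfl⟩, (hT.2.1 t ht).2 p hp]
        · exact ⟨List.mem_cons_of_mem _ (hT.2.1 u hu).1, (hT.2.1 u hu).2⟩
      · intro u hu hu'
        exact h u hu ((hiff _ _).2 hu'.symm)
    have := Nat.le_findGreatest (P := fun l => ∃ T, good T ∧ T.length = l) (hbound _ hgood)
      ⟨_, hgood, rfl⟩
    rw [← hlen, List.length_cons] at this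
    lia
  · have hi := hij.trans hj
    rw [hiff, List.getD_eq_getElem _ _ hi, List.getD_eq_getElem _ _ hj]
    exact List.pairwise_iff_getElem.1 hT.2.2 i j hi hj hij

end Transversal

/-! ### Separating words from subgroups by permutations -/

section Separation

/-- The result of applying a list of transpositions to a number, the last one first. -/
def applySwaps (l : List (ℕ × ℕ)) (x : ℕ) : ℕ :=
  l.foldr (fun p y => if y = p.1 then p.2 else if y = p.2 then p.1 else y) x

/-- The permutation given by a list of transpositions. -/
def swapPerm (l : List (ℕ × ℕ)) : Equiv.Perm ℕ := (l.map fun p => Equiv.swap p.1 p.2).prod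

/-- The result of applying a word to a number, where the letter `k` acts through the `k`-th list of
transpositions. -/
def actWord (c : List (List (ℕ × ℕ))) (w : Word) (x : ℕ) : ℕ :=
  w.foldr (fun p y => applySwaps (if p.2 then c.getD p.1 [] else (c.getD p.1 []).reverse) y) x

/-- The permutations given by `c` separate the word `w` from the subgroup of the input. -/
def IsSeparating (I : Input) (w : Word) (c : List (List (ℕ × ℕ))) : Prop :=
  (∀ v ∈ I.2.2, actWord c (restrictWord I.1 v) 0 = 0) ∧ actWord c (restrictWord I.1 w) 0 ≠ 0

theorem applySwaps_eq (l : List (ℕ × ℕ)) (x : ℕ) : applySwaps l x = swapPerm l x := by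
  induction l with
  | nil => rfl
  | cons p l ih =>
    rw [swapPerm, List.map_cons, List.prod_cons, Equiv.Perm.mul_apply, Equiv.swap_apply_def]
    simp only [applySwaps, List.foldr_cons] at ih ⊢
    rw [ih]
    rfl

theorem swapPerm_reverse (l : List (ℕ × ℕ)) : swapPerm l.reverse = (swapPerm l)⁻¹ := by
  simp [swapPerm, List.prod_inv_reverse, Function.comp_def]

theorem actWord_eq (c : List (List (ℕ × ℕ))) (w : Word) (x : ℕ) :
    actWord c w x = evalWord (fun k => swapPerm (c.getD k [])) w x := by
  induction w with
  | nil => rfl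
  | cons p w ih =>
    rw [evalWord_cons, Equiv.Perm.mul_apply, ← ih, actWord, List.foldr_cons, applySwaps_eq]
    split_ifs
    · rfl
    · rw [swapPerm_reverse]
      rfl

/-- The permutations define an action of F on ℕ in which H fixes 0 and w does not. -/
theorem IsSeparating.notMem {A : Type u} {ν : Naming A} {m : ℕ} {L : List Word} {w : Word}
    {c : List (List (ℕ × ℕ))} (h : IsSeparating (ν.size, m, L) w c) :
    ν.elt w ∉ ν.subgroup L := by
  obtain ⟨ρ, hρ⟩ := ν.exists_hom_elt
  let θ : FreeGroup A →* Equiv.Perm ℕ :=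
    (FreeGroup.lift fun k => swapPerm (c.getD k [])).comp ρ
  have hθ (v : Word) : θ (ν.elt v) 0 = actWord c (restrictWord ν.size v) 0 := by
    rw [actWord_eq, evalWord_eq_lift, ← hρ]
    rfl
  have hle : ν.subgroup L ≤ (MulAction.stabilizer (Equiv.Perm ℕ) 0).comap θ := by
    refine (Subgroup.closure_le _).2 ?_
    rintro _ ⟨v, hv, rfl⟩
    exact (hθ v).trans (h.1 v hv)
  exact fun hw => h.2 ((hθ w).symm.trans (hle hw))

/-- A finite part of a permutation extends to a product of transpositions. -/
theorem exists_swapPerm_eq {X : Type*} {num : X → ℕ} (hnum : Function.Injective num)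
    (α : Equiv.Perm X) (xs : List X) :
    ∃ l, ∀ x ∈ xs, swapPerm l (num x) = num (α x) := by
  classical
  induction xs with
  | nil => exact ⟨[], by simp⟩
  | cons y xs ih =>
    obtain ⟨l, hl⟩ := ih
    -- The new transposition carries the current image of y to its target. For x ≠ y it moves
    -- neither the image of x nor, therefore, spoils what was arranged.
    refine ⟨(swapPerm l (num y), num (α y)) :: l, fun x hx => ?_⟩
    rw [swapPerm, List.map_cons, List.prod_cons, Equiv.Perm.mul_apply]
    change Equiv.swap _ _ (swapPerm l (num x)) = _
    by_cases hxy : x = y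
    · rw [hxy, Equiv.swap_apply_left]
    · rw [Equiv.swap_apply_of_ne_of_ne]
      · exact hl x ((List.mem_cons.1 hx).resolve_left hxy)
      · exact fun h => hxy (hnum ((swapPerm l).injective h))
      · rw [hl x ((List.mem_cons.1 hx).resolve_left hxy)]
        exact fun h => hxy (α.injective (hnum h))

/-- Finitely generated subgroups of free groups are separable (M. Hall). -/
theorem exists_isSeparating {A : Type u} {n : ℕ} (e : Fin n ≃ A) (m : ℕ) {L : List Word} {w : Word}
    (h : (Naming.finite n e).elt w ∉ (Naming.finite n e).subgroup L) :
    ∃ c, IsSeparating (some n, m, L) w c := by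
  classical
  set ν := Naming.finite n e with hν
  have : Finite A := Finite.of_equiv _ e
  let X := FreeGroup A ⧸ ν.subgroup L
  let o : X := (1 : FreeGroup A)
  have : Countable X := (QuotientGroup.mk_surjective (s := ν.subgroup L)).countable
  obtain ⟨num₀, hnum₀⟩ := exists_injective_nat X
  -- The cosets of H are numbered so that the trivial one gets 0. There may be infinitely many of
  -- them, hence the finite approximations below.
  let num (x : X) : ℕ := Equiv.swap (num₀ o) 0 (num₀ x)
  have hnum : Function.Injective num := (Equiv.injective _).comp hnum₀
  have hnumo : num o = 0 := Equiv.swap_apply_left _ _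
  -- The finitely many cosets visited while the words are read from right to left: the action of
  -- each letter on the cosets only has to be imitated there.
  let xs : List X := (w :: L).flatMap fun v =>
    (restrictWord (some n) v).tails.map fun u => (ν.elt u : FreeGroup A)
  choose g hg using fun k : ℕ =>
    exists_swapPerm_eq hnum (MulAction.toPerm (ν.gen k) : Equiv.Perm X) xs
  let c := (List.range n).map g
  have hc {k : ℕ} (hk : k < n) : c.getD k [] = g k := by
    rw [List.getD_eq_getElem _ _ (by simpa [c] using hk)]
    simp [c]
  have key (u : Word) (hu : ∀ p ∈ u, p.1 < n)
      (hxs : ∀ v, v <:+ u → ((ν.elt v : FreeGroup A) : X) ∈ xs) :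
      actWord c u 0 = num (ν.elt u : FreeGroup A) := by
    induction u with
    | nil =>
      rw [Naming.elt_nil]
      exact hnumo.symm
    | cons p u ih =>
      have hcons := hxs _ List.suffix_rfl
      have hu' := hxs _ (List.suffix_cons p u)
      have := ih (fun q hq => hu q (List.mem_cons_of_mem p hq))
        fun v hv => hxs v (hv.trans (List.suffix_cons p u))
      rw [actWord, List.foldr_cons]
      change applySwaps _ (actWord c u 0) = _
      rw [this, hc (hu p List.mem_cons_self), applySwaps_eq]
      rw [Naming.elt_cons] at hcons ⊢
      split_ifs at hcons ⊢
      · exact hg _ _ hu'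
      -- An inverse letter is checked forwards, from the coset it leads to, which is also in the
      -- list.
      · rw [swapPerm_reverse, Equiv.Perm.inv_eq_iff_eq, hg _ _ hcons]
        change num _ = num (ν.gen p.1 * ((ν.gen p.1)⁻¹ * ν.elt u) : FreeGroup A)
        rw [mul_inv_cancel_left]
  have hact (v : Word) (hv : v ∈ w :: L) :
      actWord c (restrictWord (some n) v) 0 = num (ν.elt v : FreeGroup A) := by
    rw [key]
    · exact congrArg (fun g : FreeGroup A => num g) (ν.elt_restrictWord v)
    · intro p hp
      have := (List.mem_filter.1 hp).2
      exact of_decide_eq_true this n rfl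
    · intro u hu
      exact List.mem_flatMap.2 ⟨v, hv, List.mem_map_of_mem ((List.mem_tails _ _).2 hu)⟩
  refine ⟨c, fun v hv => ?_, fun h0 => h ?_⟩
  · refine (hact v (List.mem_cons_of_mem w hv)).trans (Eq.trans ?_ hnumo)
    congr 1
    rw [QuotientGroup.eq]
    simpa using ν.elt_mem_subgroup hv
  · have := hnum (((hact w List.mem_cons_self).symm.trans h0).trans hnumo.symm)
    rw [QuotientGroup.eq] at this
    simpa using this

end Separation

/-! ### Primitive recursiveness of the tests, and total search -/

section Computability

variable {α β γ : Type*} [Primcodable α] [Primcodable β] [Primcodable γ]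

theorem primrecPred_forall_mem {f : α → List β} {R : α → β → Prop} (hf : Primrec f)
    (hR : PrimrecPred fun q : α × _ => R q.1 q.2) : PrimrecPred fun a => ∀ b ∈ f a, R a b :=
  (PrimrecRel.swap (r := R) hR).forall_mem_list.comp hf Primrec.id

theorem primrecPred_exists_mem {f : α → List β} {R : α → β → Prop} (hf : Primrec f)
    (hR : PrimrecPred fun q : α × _ => R q.1 q.2) : PrimrecPred fun a => ∃ b ∈ f a, R a b :=
  (PrimrecRel.swap (r := R) hR).exists_mem_list.comp hf Primrec.id

theorem primrecPred_forall_lt {f : α → ℕ} {R : α → ℕ → Prop} (hf : Primrec f)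
    (hR : PrimrecPred fun q : α × _ => R q.1 q.2) : PrimrecPred fun a => ∀ b < f a, R a b :=
  (primrecPred_forall_mem (Primrec.list_range.comp hf) hR).of_eq fun a => by simp

theorem primrec_filter {f : α → List β} {p : α → β → Prop} [∀ a b, Decidable (p a b)]
    (hf : Primrec f) (hp : PrimrecPred fun q : α × β => p q.1 q.2) :
    Primrec fun a => (f a).filter fun b => p a b := by
  have h : Primrec₂ fun (a : α) (b : β) => if p a b then some b else none :=
    Primrec.ite hp (Primrec.option_some.comp Primrec.snd) (Primrec.const none)
  refine (Primrec.listFilterMap hf h).of_eq fun a => ?_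
  rw [← List.filterMap_eq_filter]
  congr 1
  ext1 b
  simp [Option.guard]

theorem primrec_count [BEq α] [LawfulBEq α] {f : β → α} {g : β → List α} (hf : Primrec f)
    (hg : Primrec g) : Primrec fun b => (g b).count (f b) := by
  classical
  refine (Primrec.list_length.comp (primrec_filter (p := fun b x => x = f b) hg
    (Primrec.eq.comp Primrec.snd (hf.comp Primrec.fst)))).of_eq fun b => ?_
  rw [List.count, List.countP_eq_length_filter]
  congr 2
  funext x
  rw [Bool.eq_iff_iff]
  simp

theorem primrec_reduce [DecidableEq α] : Primrec (FreeGroup.reduce (α := α)) := by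
  -- Free reduction is a right fold of this step: a letter cancels the head of the already reduced
  -- tail or is put in front of it.
  have hstep : Primrec fun q : (α × Bool) × List (α × Bool) =>
      (List.casesOn q.2 [q.1] fun hd tl =>
        if q.1.1 = hd.1 ∧ q.1.2 = !hd.2 then tl else q.1 :: hd :: tl : List (α × Bool)) := by
    refine Primrec.list_casesOn (f := fun q : (α × Bool) × List (α × Bool) => q.2)
      (h := fun q x => if q.1.1 = x.1.1 ∧ q.1.2 = !x.1.2 then x.2 else q.1 :: x.1 :: x.2) Primrec.snd
      (Primrec.list_cons.comp Primrec.fst (Primrec.const [])) ?_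
    refine Primrec.ite ?_ (Primrec.snd.comp Primrec.snd) ?_
    · exact PrimrecPred.and
        (Primrec.eq.comp (Primrec.fst.comp (Primrec.fst.comp Primrec.fst))
          (Primrec.fst.comp (Primrec.fst.comp Primrec.snd)))
        (Primrec.eq.comp (Primrec.snd.comp (Primrec.fst.comp Primrec.fst))
          (Primrec.not.comp (Primrec.snd.comp (Primrec.fst.comp Primrec.snd))))
    · exact Primrec.list_cons.comp (Primrec.fst.comp Primrec.fst)
        (Primrec.list_cons.comp (Primrec.fst.comp Primrec.snd) (Primrec.snd.comp Primrec.snd))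
  refine (Primrec.list_foldr (h := fun _ q => (List.casesOn q.2 [q.1] fun hd tl =>
    if q.1.1 = hd.1 ∧ q.1.2 = !hd.2 then tl else q.1 :: hd :: tl : List (α × Bool))) Primrec.id
    (Primrec.const []) (hstep.comp Primrec.snd).to₂).of_eq fun l => ?_
  induction l with
  | nil => rfl
  | cons p l ih =>
    rw [FreeGroup.reduce.cons, ← ih]
    rfl

theorem primrec_invRev : Primrec (FreeGroup.invRev (α := α)) :=
  Primrec.list_reverse.comp (Primrec.list_map Primrec.id
    (Primrec.pair (Primrec.fst.comp Primrec.snd)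
      (Primrec.not.comp (Primrec.snd.comp Primrec.snd))).to₂)

theorem primrecRel_isLetter : PrimrecRel IsLetter := by
  refine PrimrecPred.of_eq (p := fun q : Option ℕ × ℕ => ∀ n ∈ q.1.toList, q.2 < n)
    (primrecPred_forall_mem (Primrec.optionToList.comp Primrec.fst)
      (Primrec.nat_lt.comp (Primrec.snd.comp Primrec.fst) Primrec.snd)) fun q => ?_
  simp [IsLetter]

theorem primrec_restrictWord : Primrec₂ restrictWord :=
  primrec_filter Primrec.snd (primrecRel_isLetter.comp (Primrec.fst.comp Primrec.fst)
    (Primrec.fst.comp Primrec.snd))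

theorem primrecPred_wordEq {f : α → Option ℕ} {g h : α → Word} (hf : Primrec f) (hg : Primrec g)
    (hh : Primrec h) : PrimrecPred fun a => WordEq (f a) (g a) (h a) :=
  Primrec.eq.comp (primrec_reduce.comp (primrec_restrictWord.comp hf hg))
    (primrec_reduce.comp (primrec_restrictWord.comp hf hh))

theorem primrecPred_hasTrivialExpSum :
    PrimrecPred fun q : Option ℕ × ℕ × Word => HasTrivialExpSum q.1 q.2.1 q.2.2 := by
  have hcount (b : Bool) : Primrec fun x : (Option ℕ × ℕ × Word) × (ℕ × Bool) =>
      x.1.2.2.count (x.2.1, b) % x.1.2.1 :=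
    Primrec.nat_mod.comp (primrec_count (Primrec.pair (Primrec.fst.comp Primrec.snd)
      (Primrec.const b)) (Primrec.snd.comp (Primrec.snd.comp Primrec.fst)))
      (Primrec.fst.comp (Primrec.snd.comp Primrec.fst))
  refine primrecPred_forall_mem (Primrec.snd.comp Primrec.snd) ?_
  refine PrimrecPred.of_eq (PrimrecPred.or (PrimrecPred.not
    (primrecRel_isLetter.comp (Primrec.fst.comp Primrec.fst) (Primrec.fst.comp Primrec.snd)))
    (Primrec.eq.comp (hcount true) (hcount false))) fun x => ?_
  exact imp_iff_not_or.symm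

theorem primrec_combinations : Primrec₂ combinations := by
  refine Primrec.list_foldr (h := fun (q : ℕ × List Word) (x : Word × List Word) =>
    (List.range q.1).flatMap fun j => x.2.map fun u => (x.1 ++ ·)^[j] u)
    Primrec.snd (Primrec.const [[]]) ?_
  refine Primrec.list_flatMap (Primrec.list_range.comp (Primrec.fst.comp Primrec.fst)) ?_
  refine Primrec.list_map (Primrec.snd.comp (Primrec.snd.comp Primrec.fst)) ?_
  refine Primrec.nat_iterate (Primrec.snd.comp Primrec.fst) Primrec.snd ?_
  exact Primrec.list_append.comp
    (Primrec.fst.comp (Primrec.snd.comp (Primrec.fst.comp (Primrec.fst.comp Primrec.fst))))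
    Primrec.snd

theorem primrecRel_memClosure : PrimrecRel MemClosure := by
  refine primrecPred_exists_mem (primrec_combinations.comp
    (Primrec.fst.comp (Primrec.snd.comp Primrec.fst))
    (Primrec.snd.comp (Primrec.snd.comp Primrec.fst))) ?_
  exact primrecPred_hasTrivialExpSum.comp (Primrec.pair
    (Primrec.fst.comp (Primrec.fst.comp Primrec.fst))
    (Primrec.pair (Primrec.fst.comp (Primrec.snd.comp (Primrec.fst.comp Primrec.fst)))
      (Primrec.list_append.comp (primrec_invRev.comp Primrec.snd)
        (Primrec.snd.comp Primrec.fst))))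

theorem primrec_size_getD : Primrec fun I : Input => I.1.getD 0 :=
  Primrec.option_getD.comp Primrec.fst (Primrec.const 0)

theorem primrecPred_memClosure_invRev_append {f : α → Input} {g h : α → Word} (hf : Primrec f)
    (hg : Primrec g) (hh : Primrec h) :
    PrimrecPred fun a => MemClosure (f a) (FreeGroup.invRev (g a) ++ h a) :=
  primrecRel_memClosure.comp hf (Primrec.list_append.comp (primrec_invRev.comp hg) hh)

theorem primrec_cons_letter {f : α → ℕ} {g : α → Word} (hf : Primrec f) (hg : Primrec g) :
    Primrec fun a => (f a, true) :: g a :=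
  Primrec.list_cons.comp (Primrec.pair hf (Primrec.const true)) hg

theorem primrecRel_isTransversal : PrimrecRel IsTransversal := by
  have hn : Primrec fun q : Input × List Word => q.1.1.getD 0 := primrec_size_getD.comp Primrec.fst
  have hmem {γ : Type} [Primcodable γ] {f : γ → Word} {g : γ → List Word} (hf : Primrec f)
      (hg : Primrec g) : PrimrecPred fun c => f c ∈ g c :=
    (primrecPred_exists_mem (R := fun c t => f c = t) hg
      (Primrec.eq.comp (hf.comp Primrec.fst) Primrec.snd)).of_eq fun c => by simp
  refine PrimrecPred.and (hmem (Primrec.const []) Primrec.snd) (PrimrecPred.and ?_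
    (PrimrecPred.and ?_ ?_))
  · refine primrecPred_forall_mem Primrec.snd (PrimrecPred.and
      (hmem (Primrec.list_tail.comp Primrec.snd) (Primrec.snd.comp Primrec.fst)) ?_)
    refine primrecPred_forall_mem Primrec.snd (PrimrecPred.and
      (Primrec.nat_lt.comp (Primrec.fst.comp Primrec.snd)
        (hn.comp (Primrec.fst.comp Primrec.fst)))
      (Primrec.eq.comp (Primrec.snd.comp Primrec.snd) (Primrec.const true)))
  · refine primrecPred_forall_lt hn (primrecPred_forall_mem (Primrec.snd.comp Primrec.fst)
      (primrecPred_exists_mem (Primrec.snd.comp (Primrec.fst.comp Primrec.fst)) ?_))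
    exact primrecPred_memClosure_invRev_append
      (Primrec.fst.comp (Primrec.fst.comp (Primrec.fst.comp Primrec.fst))) Primrec.snd
      (primrec_cons_letter (Primrec.snd.comp (Primrec.fst.comp Primrec.fst))
        (Primrec.snd.comp Primrec.fst))
  · refine primrecPred_forall_lt (Primrec.list_length.comp Primrec.snd)
      (primrecPred_forall_lt Primrec.snd (PrimrecPred.not
        (primrecPred_memClosure_invRev_append
          (Primrec.fst.comp (Primrec.fst.comp Primrec.fst)) ?_ ?_)))
    · exact (Primrec.list_getD []).comp (Primrec.snd.comp (Primrec.fst.comp Primrec.fst))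
        Primrec.snd
    · exact (Primrec.list_getD []).comp (Primrec.snd.comp (Primrec.fst.comp Primrec.fst))
        (Primrec.snd.comp Primrec.fst)

theorem primrec_cosetRep {f : α → Input} {g : α → List Word} {h : α → Word} (hf : Primrec f)
    (hg : Primrec g) (hh : Primrec h) : Primrec fun a => cosetRep (f a) (g a) (h a) := by
  classical
  exact (Primrec.list_getD []).comp hg (Primrec.list_findIdx hg
    (primrecPred_memClosure_invRev_append (hf.comp Primrec.fst) Primrec.snd
      (hh.comp Primrec.fst)).decide.to₂)

theorem primrec_basisWords : Primrec₂ basisWords := by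
  classical
  have hrep {α : Type} [Primcodable α] {f : α → Input × List Word} {g : α → Word × ℕ}
      (hf : Primrec f) (hg : Primrec g) :
      Primrec fun a => cosetRep (f a).1 (f a).2 (((g a).2, true) :: (g a).1) :=
    primrec_cosetRep (Primrec.fst.comp hf) (Primrec.snd.comp hf)
      (primrec_cons_letter (Primrec.snd.comp hg) (Primrec.fst.comp hg))
  refine Primrec.list_map (primrec_filter ?_ (PrimrecPred.not (primrecPred_wordEq
    (Primrec.fst.comp (Primrec.fst.comp Primrec.fst)) (hrep Primrec.fst Primrec.snd)
    (primrec_cons_letter (Primrec.snd.comp Primrec.snd) (Primrec.fst.comp Primrec.snd))))) ?_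
  · refine Primrec.list_flatMap Primrec.snd (Primrec.list_map
      (Primrec.list_range.comp (primrec_size_getD.comp (Primrec.fst.comp Primrec.fst))) ?_)
    exact Primrec.pair (Primrec.snd.comp Primrec.fst) Primrec.snd
  · exact Primrec.list_append.comp (primrec_invRev.comp (hrep Primrec.fst Primrec.snd))
      (primrec_cons_letter (Primrec.snd.comp Primrec.snd) (Primrec.fst.comp Primrec.snd))

theorem primrec_applySwaps : Primrec₂ applySwaps := by
  refine Primrec.list_foldr (h := fun (_ : List (ℕ × ℕ) × ℕ) (q : (ℕ × ℕ) × ℕ) =>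
    if q.2 = q.1.1 then q.1.2 else if q.2 = q.1.2 then q.1.1 else q.2) Primrec.fst Primrec.snd ?_
  have hy : Primrec fun a : (List (ℕ × ℕ) × ℕ) × (ℕ × ℕ) × ℕ => a.2.2 :=
    Primrec.snd.comp Primrec.snd
  have h1 : Primrec fun a : (List (ℕ × ℕ) × ℕ) × (ℕ × ℕ) × ℕ => a.2.1.1 :=
    Primrec.fst.comp (Primrec.fst.comp Primrec.snd)
  have h2 : Primrec fun a : (List (ℕ × ℕ) × ℕ) × (ℕ × ℕ) × ℕ => a.2.1.2 :=
    Primrec.snd.comp (Primrec.fst.comp Primrec.snd)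
  exact Primrec.ite (Primrec.eq.comp hy h1) h2 (Primrec.ite (Primrec.eq.comp hy h2) h1 hy)

theorem primrec_actWord {f : α → List (List (ℕ × ℕ))} {g : α → Word} (hf : Primrec f)
    (hg : Primrec g) : Primrec fun a => actWord (f a) (g a) 0 := by
  refine Primrec.list_foldr (h := fun (a : α) (q : (ℕ × Bool) × ℕ) => applySwaps
      (if q.1.2 then (f a).getD q.1.1 [] else ((f a).getD q.1.1 []).reverse) q.2)
    hg (Primrec.const 0) (primrec_applySwaps.comp ?_ (Primrec.snd.comp Primrec.snd))
  have hl : Primrec fun x : α × (ℕ × Bool) × ℕ => (f x.1).getD x.2.1.1 [] :=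
    (Primrec.list_getD []).comp (hf.comp Primrec.fst)
      (Primrec.fst.comp (Primrec.fst.comp Primrec.snd))
  exact Primrec.ite (Primrec.eq.comp (Primrec.snd.comp (Primrec.fst.comp Primrec.snd))
    (Primrec.const true)) hl (Primrec.list_reverse.comp hl)

theorem primrecPred_isSeparating {f : α → Input} {g : α → Word} {h : α → List (List (ℕ × ℕ))}
    (hf : Primrec f) (hg : Primrec g) (hh : Primrec h) :
    PrimrecPred fun a => IsSeparating (f a) (g a) (h a) := by
  refine PrimrecPred.and (primrecPred_forall_mem (Primrec.snd.comp (Primrec.snd.comp hf))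
    (Primrec.eq.comp (primrec_actWord (hh.comp Primrec.fst) (primrec_restrictWord.comp
      (Primrec.fst.comp (hf.comp Primrec.fst)) Primrec.snd)) (Primrec.const 0))) ?_
  exact PrimrecPred.not (Primrec.eq.comp (primrec_actWord hh
    (primrec_restrictWord.comp (Primrec.fst.comp hf) hg)) (Primrec.const 0))

/-- Total search: a computable relation with nonempty sections has a computable choice function. -/
theorem exists_computable_choice [Inhabited β] {P : α → β → Prop}
    (hP : ComputablePred fun q : α × β => P q.1 q.2) (h : ∀ a, ∃ b, P a b) :
    ∃ f : α → β, Computable f ∧ ∀ a, P a (f a) := by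
  classical
  -- An enumeration of β; codes of nothing give the default value, which is harmless since each
  -- candidate is tested.
  let d (k : ℕ) : β := (Encodable.decode k).getD default
  have hd : Computable d := (Primrec.option_getD.comp Primrec.decode (Primrec.const default)).to_comp
  have hex (a : α) : ∃ k, P a (d k) := by
    obtain ⟨b, hb⟩ := h a
    exact ⟨Encodable.encode b, by simpa [d] using hb⟩
  have hP' : ComputablePred fun q : α × ℕ => P q.1 (d q.2) :=
    Computable.computablePred
      (hP.decide.comp (Computable.pair Computable.fst (hd.comp Computable.snd)))
  exact ⟨fun a => d (Nat.find (hex a)), hd.comp (Computable.find hP' hex),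
    fun a => Nat.find_spec (hex a)⟩

end Computability

/-! ### The algorithms for bases, expressions, density and closedness -/

section Algorithms

/-- The word `w` over the words `L`, with letters in `L`, represents the same element as `v`. -/
def IsExpression (s : Option ℕ) (L : List Word) (v : Word) (w : List (Word × Bool)) : Prop :=
  (∀ p ∈ w, p.1 ∈ L) ∧
    WordEq s (w.flatMap fun p => if p.2 then p.1 else FreeGroup.invRev p.1) v

variable {A : Type u} {L : List Word}

namespace Naming

theorem elt_flatMap (ν : Naming A) (w : List (Word × Bool)) :
    ν.elt (w.flatMap fun p => if p.2 then p.1 else FreeGroup.invRev p.1) = evalWord ν.elt w := by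
  induction w with
  | nil => simp [evalWord]
  | cons p w ih =>
    rw [List.flatMap_cons, elt_append, ih, evalWord_cons]
    split_ifs
    · rfl
    · rw [elt_invRev]

theorem isExpression_iff (ν : Naming A) {v : Word} {w : List (Word × Bool)} :
    IsExpression ν.size L v w ↔ (∀ p ∈ w, p.1 ∈ L) ∧ evalWord ν.elt w = ν.elt v := by
  rw [IsExpression, ← ν.elt_eq_elt_iff, elt_flatMap]

theorem mem_subgroup_iff (ν : Naming A) {v : Word} :
    ν.elt v ∈ ν.subgroup L ↔ ∃ w, IsExpression ν.size L v w := by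
  simp only [isExpression_iff]
  refine ⟨fun h => exists_evalWord_eq (s := {w | w ∈ L}) h, fun ⟨w, hw, h⟩ => ?_⟩
  exact h ▸ evalWord_mem fun p hp => ν.elt_mem_subgroup (hw p hp)

theorem subgroup_eq_of_isBasisOf (ν : Naming A) {K : Subgroup (FreeGroup A)}
    (h : IsBasisOf (fun i : Fin L.length => ν.elt (L.get i)) K) : ν.subgroup L = K := by
  rw [← h.closure_range, subgroup]
  congr 1
  ext g
  simp [List.exists_mem_iff_getElem, Fin.exists_iff]

end Naming

/-- A certificate showing that the subgroup of an input over a finite alphabet is closed, or that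
it is not: expressions for the words `W` generating the closure, or a word in the closure and
permutations which separate it from the subgroup. -/
def IsCertificate (I : Input) (W : List Word) :
    List (List (Word × Bool)) ⊕ (Word × List (List (ℕ × ℕ))) → Prop
  | .inl Q => ∀ v ∈ W, ∃ q ∈ Q, IsExpression I.1 I.2.2 v q
  | .inr (w, c) => MemClosure I w ∧ IsSeparating I w c

/-- Soundness: W generates the closure, so expressions for W put the closure inside H, while a
separated word lies in the closure but not in H. -/
theorem Naming.isProClosed_of_isCertificate (ν : Naming A) {m : ℕ} (hm : 1 ≤ m) {W : List Word}
    (hW : IsBasisOf (fun i : Fin W.length => ν.elt (W.get i)) (ν.closed m L))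
    {C : List (List (Word × Bool)) ⊕ (Word × List (List (ℕ × ℕ)))}
    (hC : IsCertificate (ν.size, m, L) W C) :
    C.isLeft = true ↔ IsProClosed (Ab m) (ν.subgroup L) := by
  rw [isProClosed_ab_iff_proClosure_le hm]
  rcases C with Q | ⟨w, c⟩
  · refine iff_of_true rfl ?_
    change ν.closed m L ≤ _
    rw [← ν.subgroup_eq_of_isBasisOf hW]
    refine (Subgroup.closure_le _).2 ?_
    rintro _ ⟨v, hv, rfl⟩
    obtain ⟨q, -, hq⟩ := hC v hv
    exact ν.mem_subgroup_iff.2 ⟨q, hq⟩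
  · refine iff_of_false (by simp) fun h => ?_
    exact hC.2.notMem (h ((ν.memClosure_iff hm).1 hC.1))

/-- Completeness, which makes the search stop: if some word of W is outside H, M. Hall's theorem
separates it. -/
theorem exists_isCertificate (n m : ℕ) (hm : 1 ≤ m) (L : List Word) {W : List Word}
    (hW : IsBasisOf (fun i : Fin W.length =>
      (Naming.finite n (Equiv.refl (Fin n))).elt (W.get i))
      ((Naming.finite n (Equiv.refl (Fin n))).closed m L)) :
    ∃ C, IsCertificate (some n, m, L) W C := by
  set ν := Naming.finite n (Equiv.refl (Fin n)) with hν
  by_cases h : ∀ v ∈ W, ν.elt v ∈ ν.subgroup L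
  · choose! q hq using fun v hv => ν.mem_subgroup_iff.1 (h v hv)
    exact ⟨.inl (W.map q), fun v hv => ⟨q v, List.mem_map_of_mem hv, hq v hv⟩⟩
  · push Not at h
    obtain ⟨w, hw, hwL⟩ := h
    obtain ⟨c, hc⟩ := exists_isSeparating (Equiv.refl (Fin n)) m hwL
    refine ⟨.inr (w, c), (ν.memClosure_iff hm).2 ?_, hc⟩
    change _ ∈ ν.closed m L
    rw [← ν.subgroup_eq_of_isBasisOf hW]
    exact ν.elt_mem_subgroup hw

theorem primrecPred_isExpression {α : Type*} [Primcodable α] {f : α → Option ℕ}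
    {g : α → List Word} {h : α → Word} {k : α → List (Word × Bool)} (hf : Primrec f)
    (hg : Primrec g) (hh : Primrec h) (hk : Primrec k) :
    PrimrecPred fun a => IsExpression (f a) (g a) (h a) (k a) := by
  refine PrimrecPred.and (primrecPred_forall_mem hk ?_) (primrecPred_wordEq hf ?_ hh)
  · refine (primrecPred_exists_mem (R := fun (x : α × (Word × Bool)) u => x.2.1 = u)
      (hg.comp Primrec.fst) (Primrec.eq.comp (Primrec.fst.comp (Primrec.snd.comp Primrec.fst))
        Primrec.snd)).of_eq fun x => by simp
  · refine Primrec.list_flatMap hk ?_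
    exact Primrec.ite (Primrec.eq.comp (Primrec.snd.comp Primrec.snd) (Primrec.const true))
      (Primrec.fst.comp Primrec.snd) (primrec_invRev.comp (Primrec.fst.comp Primrec.snd))

theorem primrecPred_isCertificate : PrimrecPred fun q : (Input × List Word) ×
    (List (List (Word × Bool)) ⊕ (Word × List (List (ℕ × ℕ)))) =>
      IsCertificate q.1.1 q.1.2 q.2 := by
  classical
  have h1 : PrimrecPred fun x : ((Input × List Word) ×
      (List (List (Word × Bool)) ⊕ (Word × List (List (ℕ × ℕ))))) × List (List (Word × Bool)) =>
      ∀ v ∈ x.1.1.2, ∃ q ∈ x.2, IsExpression x.1.1.1.1 x.1.1.1.2.2 v q := by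
    refine primrecPred_forall_mem (Primrec.snd.comp (Primrec.fst.comp Primrec.fst))
      (primrecPred_exists_mem (Primrec.snd.comp Primrec.fst) (primrecPred_isExpression ?_ ?_
        (Primrec.snd.comp Primrec.fst) Primrec.snd))
    · exact Primrec.fst.comp (Primrec.fst.comp (Primrec.fst.comp (Primrec.fst.comp
        (Primrec.fst.comp Primrec.fst))))
    · exact Primrec.snd.comp (Primrec.snd.comp (Primrec.fst.comp (Primrec.fst.comp
        (Primrec.fst.comp (Primrec.fst.comp Primrec.fst)))))
  have h2 : PrimrecPred fun x : ((Input × List Word) ×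
      (List (List (Word × Bool)) ⊕ (Word × List (List (ℕ × ℕ))))) × (Word × List (List (ℕ × ℕ))) =>
      MemClosure x.1.1.1 x.2.1 ∧ IsSeparating x.1.1.1 x.2.1 x.2.2 := by
    have hI : Primrec fun x : ((Input × List Word) × (List (List (Word × Bool)) ⊕
        (Word × List (List (ℕ × ℕ))))) × (Word × List (List (ℕ × ℕ))) => x.1.1.1 :=
      Primrec.fst.comp (Primrec.fst.comp Primrec.fst)
    exact PrimrecPred.and (primrecRel_memClosure.comp hI (Primrec.fst.comp Primrec.snd))
      (primrecPred_isSeparating hI (Primrec.fst.comp Primrec.snd) (Primrec.snd.comp Primrec.snd))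
  refine Primrec.primrecPred ?_
  refine (Primrec.sumCasesOn Primrec.snd h1.decide.to₂ h2.decide.to₂).of_eq ?_
  rintro ⟨I, Q | ⟨w, c⟩⟩ <;> exact decide_eq_decide.2 Iff.rfl

theorem IsBasisOf.subtype_mem_list {x : Word → FreeGroup A} {K : Subgroup (FreeGroup A)}
    (h : IsBasisOf (fun i : Fin L.length => x (L.get i)) K) :
    IsBasisOf (fun b : {w | w ∈ L} => x b) K := by
  classical
  have hL : L.Nodup :=
    List.nodup_iff_injective_get.2 fun i j hij => h.injective (congrArg x hij)
  have hx : (fun b : {w // w ∈ L} => x (L.get ((hL.getEquiv L).symm b))) = fun b => x b.1 :=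
    funext fun b => congrArg x (congrArg Subtype.val ((hL.getEquiv L).apply_symm_apply b))
  have := h.reindex (hL.getEquiv L).symm
  rw [hx] at this
  exact this

theorem primrecPred_imp {α : Type*} [Primcodable α] {p q : α → Prop} (hp : PrimrecPred p)
    (hq : PrimrecPred q) : PrimrecPred fun a => p a → q a :=
  (hp.not.or hq).of_eq fun _ => imp_iff_not_or.symm

theorem computablePred_comp {α β : Type*} [Primcodable α] [Primcodable β] {p : β → Prop}
    {f : α → β} (hp : PrimrecPred p) (hf : Computable f) : ComputablePred fun a => p (f a) := by
  classical
  exact Computable.computablePred (hp.decide.to_comp.comp hf)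

/-- The inputs to which the computation of a basis applies. -/
def Input.IsFinite (I : Input) : Prop := I.1.isSome = true ∧ 1 ≤ I.2.1

theorem primrecPred_isFinite : PrimrecPred Input.IsFinite :=
  (Primrec.eq.comp (Primrec.option_isSome.comp Primrec.fst) (Primrec.const true)).and
    (Primrec.nat_le.comp (Primrec.const 1) (Primrec.fst.comp Primrec.snd))

/-- Total search needs an answer on every input: outside the finite case with m ≥ 1 the condition is
vacuous, and otherwise `exists_isTransversal` applies. -/
theorem exists_computable_transversal : ∃ g : Input → List Word, Computable g ∧
    ∀ I : Input, I.IsFinite → IsTransversal I (g I) := by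
  refine exists_computable_choice (P := fun (I : Input) T => I.IsFinite → IsTransversal I T)
    (primrecPred_imp (primrecPred_isFinite.comp Primrec.fst)
      primrecRel_isTransversal).computablePred ?_
  rintro ⟨s, m, L⟩
  by_cases h : Input.IsFinite (s, m, L)
  · obtain ⟨n, rfl⟩ := Option.isSome_iff_exists.1 h.1
    obtain ⟨T, hT⟩ := exists_isTransversal n h.2 L
    exact ⟨T, fun _ => hT⟩
  · exact ⟨[], fun h' => absurd h' h⟩

theorem Naming.finite_iff (ν : Naming A) : Finite A ↔ ν.size.isSome = true := by
  cases ν with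
  | finite n e => simpa [size] using Finite.of_equiv _ e
  | infinite e => simpa [size] using Infinite.of_injective _ e.injective

/-- A basis of the closure is computable, by the same algorithm for alphabets in `Type u` and in
`Type`. -/
theorem exists_computable_basis : ∃ f : Input → List Word, Computable f ∧
    (∀ (A : Type u) [Finite A] (ν : Naming A) (m : ℕ) (L : List Word), 1 ≤ m →
      IsBasisOf (fun i : Fin (f (ν.size, m, L)).length => ν.elt ((f (ν.size, m, L)).get i))
        (ν.closed m L)) ∧
    ∀ (A : Type) [Finite A] (ν : Naming A) (m : ℕ) (L : List Word), 1 ≤ m →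
      IsBasisOf (fun i : Fin (f (ν.size, m, L)).length => ν.elt ((f (ν.size, m, L)).get i))
        (ν.closed m L) := by
  obtain ⟨g, hg, hgT⟩ := exists_computable_transversal
  refine ⟨fun I => basisWords I (g I), primrec_basisWords.to_comp.comp Computable.id hg, ?_, ?_⟩
  all_goals
    intro A _ ν m L hm
    cases ν with
    | finite n e => exact (hgT (some n, m, L) ⟨rfl, hm⟩).isBasisOf hm
    | infinite e => exact absurd ((Naming.infinite e).finite_iff.1 ‹_›) (by simp [Naming.size])

/-- Expressions of the elements of the closure in a computable basis can be computed. -/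
theorem exists_computable_expression {f : Input → List Word} (hf : Computable f)
    (hbasis : ∀ (n m : ℕ) (L : List Word), 1 ≤ m →
      IsBasisOf (fun i : Fin (f (some n, m, L)).length =>
        (Naming.finite n (Equiv.refl (Fin n))).elt ((f (some n, m, L)).get i))
        ((Naming.finite n (Equiv.refl (Fin n))).closed m L)) :
    ∃ k : Input × Word → List (Word × Bool), Computable k ∧
      ∀ (I : Input) (w : Word), I.IsFinite → MemClosure I w →
        IsExpression I.1 (f I) w (k (I, w)) := by
  -- Since membership in the closure is decidable, it can be a premise of the test, so the search
  -- also stops on words outside the closure.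
  let P (q : Input × Word) (e : List (Word × Bool)) : Prop :=
    (q.1.IsFinite ∧ MemClosure q.1 q.2) → IsExpression q.1.1 (f q.1) q.2 e
  have hP : ComputablePred fun y : (Input × Word) × List (Word × Bool) => P y.1 y.2 := by
    refine computablePred_comp (p := fun x : ((Input × Word) × List Word) × List (Word × Bool) =>
        (x.1.1.1.IsFinite ∧ MemClosure x.1.1.1 x.1.1.2) →
          IsExpression x.1.1.1.1 x.1.2 x.1.1.2 x.2)
      (f := fun y : (Input × Word) × List (Word × Bool) => ((y.1, f y.1.1), y.2)) ?_ ?_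
    · have hI : Primrec fun x : ((Input × Word) × List Word) × List (Word × Bool) => x.1.1.1 :=
        Primrec.fst.comp (Primrec.fst.comp Primrec.fst)
      have hw : Primrec fun x : ((Input × Word) × List Word) × List (Word × Bool) => x.1.1.2 :=
        Primrec.snd.comp (Primrec.fst.comp Primrec.fst)
      exact primrecPred_imp
        ((primrecPred_isFinite.comp hI).and (primrecRel_memClosure.comp hI hw))
        (primrecPred_isExpression (Primrec.fst.comp hI) (Primrec.snd.comp Primrec.fst) hw
          Primrec.snd)
    · exact Computable.pair (Computable.pair Computable.fst
        (hf.comp (Computable.fst.comp Computable.fst))) Computable.snd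
  have hex : ∀ q, ∃ e, P q e := by
    rintro ⟨⟨s, m, L⟩, w⟩
    by_cases h : Input.IsFinite (s, m, L) ∧ MemClosure (s, m, L) w
    · obtain ⟨n, rfl⟩ := Option.isSome_iff_exists.1 h.1.1
      have hm : 1 ≤ m := h.1.2
      have hw : _ ∈ (Naming.finite n (Equiv.refl (Fin n))).closed m L :=
        (Naming.memClosure_iff _ hm).1 h.2
      rw [← Naming.subgroup_eq_of_isBasisOf _ (hbasis n m L hm), Naming.mem_subgroup_iff] at hw
      obtain ⟨e, he⟩ := hw
      exact ⟨e, fun _ => he⟩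
    · exact ⟨[], fun h' => absurd h' h⟩
  obtain ⟨k, hk, h⟩ := exists_computable_choice hP hex
  exact ⟨k, hk, fun I w h1 h2 => h (I, w) ⟨h1, h2⟩⟩

theorem exists_computable_memClosure : ∃ f : Input × Word → Bool, Computable f ∧
    ∀ (A : Type u) (ν : Naming A) (m : ℕ) (L : List Word) (w : Word), 1 ≤ m →
      (f ((ν.size, m, L), w) = true ↔ ν.elt w ∈ proClosure (Ab m) (ν.subgroup L)) := by
  classical
  exact ⟨fun q => MemClosure q.1 q.2, primrecRel_memClosure.decide.to_comp,
    fun A ν m L w hm => by simp [← ν.memClosure_iff hm]⟩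

theorem isDecidable_fg : IsDecidable.{u} fun _ m H => (proClosure (Ab m) H).FG :=
  ⟨fun I => I.1.isSome, (Primrec.option_isSome.comp Primrec.fst).to_comp, fun _ ν _ _ hm =>
    ν.finite_iff.symm.trans (proClosure_ab_fg_iff hm _).symm⟩

/-- Over a finite alphabet it suffices to test that each letter is in the closure; over an infinite
one density means m = 1. -/
theorem isDecidable_isProDense : IsDecidable.{u} fun _ m H => IsProDense (Ab m) H := by
  classical
  have h : PrimrecPred fun I : Input => (I.1.isSome = true ∧
      ∀ k < I.1.getD 0, MemClosure I [(k, true)]) ∨ (¬ I.1.isSome = true ∧ I.2.1 = 1) := by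
    have hs : PrimrecPred fun I : Input => I.1.isSome = true :=
      Primrec.eq.comp (Primrec.option_isSome.comp Primrec.fst) (Primrec.const true)
    refine PrimrecPred.or (hs.and (primrecPred_forall_lt primrec_size_getD
      (primrecRel_memClosure.comp Primrec.fst (primrec_cons_letter Primrec.snd
        (Primrec.const []))))) (hs.not.and ?_)
    exact Primrec.eq.comp (Primrec.fst.comp Primrec.snd) (Primrec.const 1)
  refine ⟨_, h.decide.to_comp, fun A ν m L hm => ?_⟩
  rw [decide_eq_true_iff]
  cases ν with
  | finite n e =>
    have hmem (k : Fin n) : MemClosure (some n, m, L) [((k : ℕ), true)] ↔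
        FreeGroup.of (e k) ∈ (Naming.finite n e).subgroup L ⊔ abVerbal (FreeGroup A) m := by
      refine ((Naming.finite n e).memClosure_iff_mem_sup hm).trans ?_
      rw [Naming.elt_cons, if_pos rfl, Naming.gen_finite, Naming.elt_nil, mul_one]
    refine Iff.trans ?_ (isProDense_ab_iff hm _).symm
    simp only [Naming.size, Option.isSome_some, true_and, not_true_eq_false, false_and, or_false,
      Option.getD_some]
    refine ⟨fun h => top_unique ?_, fun h k hk => (hmem ⟨k, hk⟩).2 (h ▸ Subgroup.mem_top _)⟩
    rw [← FreeGroup.closure_range_of, Subgroup.closure_le]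
    rintro _ ⟨a, rfl⟩
    obtain ⟨k, rfl⟩ := e.surjective a
    exact (hmem k).1 (h k k.2)
  | infinite e =>
    have := Infinite.of_injective _ e.injective
    refine Iff.trans ?_ (isProDense_ab_iff_of_infinite hm (Naming.fg_subgroup _ L)).symm
    simp [Naming.size]

theorem isDecidable_isProClosed : IsDecidable.{u} fun _ m H => IsProClosed (Ab m) H := by
  obtain ⟨f, hf, hbasis, hbasis₀⟩ := exists_computable_basis.{u}
  obtain ⟨C, hC, h⟩ := exists_computable_choice
    (P := fun (I : Input) C => I.IsFinite → IsCertificate I (f I) C)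
    (computablePred_comp (f := fun y : Input × (List (List (Word × Bool)) ⊕
        (Word × List (List (ℕ × ℕ)))) => ((y.1, f y.1), y.2))
      (primrecPred_imp (primrecPred_isFinite.comp (Primrec.fst.comp Primrec.fst))
        primrecPred_isCertificate)
      (Computable.pair (Computable.pair Computable.fst (hf.comp Computable.fst)) Computable.snd))
    (by
      rintro ⟨s, m, L⟩
      by_cases h : Input.IsFinite (s, m, L)
      · obtain ⟨n, rfl⟩ := Option.isSome_iff_exists.1 h.1
        -- The search sees only the size n, so existence is proved over `Fin n`; this alphabet lies
        -- in `Type`, which is why the basis is also needed there.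
        obtain ⟨C, hC⟩ := exists_isCertificate n m h.2 L
          (hbasis₀ _ (Naming.finite n (Equiv.refl (Fin n))) m L h.2)
        exact ⟨C, fun _ => hC⟩
      · exact ⟨.inl [], fun h' => absurd h' h⟩)
  have hleft : Primrec fun C : List (List (Word × Bool)) ⊕ (Word × List (List (ℕ × ℕ))) =>
      C.isLeft :=
    (Primrec.sumCasesOn Primrec.id (Primrec.const true).to₂ (Primrec.const false).to₂).of_eq
      fun C => by cases C <;> rfl
  refine ⟨fun I => I.1.isSome && (C I).isLeft, Primrec.and.to_comp.comp
    (Primrec.option_isSome.comp Primrec.fst).to_comp (hleft.to_comp.comp hC),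
    fun A ν m L hm => ?_⟩
  by_cases hA : Finite A
  · have hs := ν.finite_iff.1 hA
    simp only [hs, Bool.true_and]
    exact ν.isProClosed_of_isCertificate hm (hbasis A ν m L hm) (h _ ⟨hs, hm⟩)
  · have hs := ν.finite_iff.not.1 hA
    rw [not_finite_iff_infinite] at hA
    exact iff_of_false (by simp [hs]) (not_isProClosed_ab_of_infinite hm (ν.fg_subgroup L))

end Algorithms

end ProV

/-! ### The theorem -/

theorem theorem5p1 :
    -- the algebraic assertions, over an arbitrary alphabet
    (∀ (A : Type u) (m : ℕ) (H : Subgroup (FreeGroup A)), 1 ≤ m → H.FG →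
      ((ProV.proClosure (ProV.Ab m) H : Set (FreeGroup A)) =
        (H : Set (FreeGroup A)) * (commutator (FreeGroup A) : Set (FreeGroup A)) *
          (ProV.powSubgroup (FreeGroup A) m : Set (FreeGroup A))) ∧
      ((ProV.proClosure (ProV.Ab m) H).FG ↔ Finite A) ∧
      (ProV.IsProDense (ProV.Ab m) H ↔
        ∀ p : ℕ, p.Prime → p ∣ m → ProV.IsProDense (ProV.Ab p) H)) ∧
    -- it is decidable whether the closure is finitely generated
    ProV.IsDecidable.{u} (fun _ m H => (ProV.proClosure (ProV.Ab m) H).FG) ∧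
    -- a basis of the closure is computable whenever the closure is finitely generated
    (∃ f : ProV.Input → List ProV.Word, Computable f ∧
      ∀ (A : Type u) (ν : ProV.Naming A) (m : ℕ) (L : List ProV.Word), 1 ≤ m →
        (ProV.proClosure (ProV.Ab m) (ν.subgroup L)).FG →
        ProV.IsBasisOf (fun i : Fin (f (ν.size, m, L)).length => ν.elt ((f (ν.size, m, L)).get i))
          (ProV.proClosure (ProV.Ab m) (ν.subgroup L))) ∧
    -- it is decidable whether `H` is closed, and whether `H` is dense
    ProV.IsDecidable.{u} (fun _ m H => ProV.IsProClosed (ProV.Ab m) H) ∧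
    ProV.IsDecidable.{u} (fun _ m H => ProV.IsProDense (ProV.Ab m) H) ∧
    -- the membership problem for the closure is decidable
    (∃ f : ProV.Input × ProV.Word → Bool, Computable f ∧
      ∀ (A : Type u) (ν : ProV.Naming A) (m : ℕ) (L : List ProV.Word) (w : ProV.Word), 1 ≤ m →
        (f ((ν.size, m, L), w) = true ↔
          ν.elt w ∈ ProV.proClosure (ProV.Ab m) (ν.subgroup L))) ∧
    -- for finite `A`, a recursively enumerable basis `B`, and an algorithm that expresses the
    -- elements of the closure as words on `B`
    (∃ (B : ProV.Input → Set ProV.Word)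
        (f : ProV.Input × ProV.Word → List (ProV.Word × Bool)),
      REPred (fun q : ProV.Input × ProV.Word => q.2 ∈ B q.1) ∧ Computable f ∧
      ∀ (A : Type u) [Finite A] (ν : ProV.Naming A) (m : ℕ) (L : List ProV.Word), 1 ≤ m →
        ProV.IsBasisOf (fun b : B (ν.size, m, L) => ν.elt b)
          (ProV.proClosure (ProV.Ab m) (ν.subgroup L)) ∧
        ∀ w : ProV.Word, ν.elt w ∈ ProV.proClosure (ProV.Ab m) (ν.subgroup L) →
          (∀ p ∈ f ((ν.size, m, L), w), p.1 ∈ B (ν.size, m, L)) ∧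
          ProV.evalWord ν.elt (f ((ν.size, m, L), w)) = ν.elt w) := by
  obtain ⟨f, hf, hbasis, hbasis₀⟩ := ProV.exists_computable_basis.{u}
  refine ⟨fun A m H hm hH => ⟨ProV.coe_proClosure_ab hm H, ProV.proClosure_ab_fg_iff hm H,
    ProV.isProDense_ab_iff_forall_prime hm H⟩, ProV.isDecidable_fg, ⟨f, hf, ?_⟩,
    ProV.isDecidable_isProClosed, ProV.isDecidable_isProDense, ProV.exists_computable_memClosure,
    ?_⟩
  · intro A ν m L hm hfg
    have := (ProV.proClosure_ab_fg_iff hm _).1 hfg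
    exact hbasis A ν m L hm
  · obtain ⟨k, hk, hexp⟩ := ProV.exists_computable_expression hf
      fun n m L hm => hbasis₀ _ (.finite n (Equiv.refl (Fin n))) m L hm
    -- B consists of the entries of the computed finite list, so membership in it is even decidable.
    refine ⟨fun I => {w | w ∈ f I}, k, ?_, hk, fun A _ ν m L hm => ⟨?_, fun w hw => ?_⟩⟩
    · refine (ProV.computablePred_comp (p := fun q : List ProV.Word × ProV.Word => ∃ v ∈ q.1, v = q.2)
        (ProV.primrecPred_exists_mem Primrec.fst (Primrec.eq.comp Primrec.snd
          (Primrec.snd.comp Primrec.fst)))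
        (Computable.pair (hf.comp Computable.fst) Computable.snd)).to_re.of_eq fun q => by simp
    · exact (hbasis A ν m L hm).subtype_mem_list
    · exact ν.isExpression_iff.1 (hexp (ν.size, m, L) w ⟨ν.finite_iff.1 ‹_›, hm⟩
        ((ν.memClosure_iff hm).2 hw))
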